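/- Let $d,n\ge 2$. For $m\ge 2$ let $G(d,d,m)$ be the group of monomial $m\times m$ complex matrices whose non-zero entries are $d$-th roots of unity with product $1$. Let $T$ be its set of reflections, let $\ell_T(w)$ be the minimal number of factors in an expression of $w\in G(d,d,m)$ as a product of elements of $T$, and let $u\le_T v$ if and only if $\ell_T(v)=\ell_T(u)+\ell_T(u^{-1}v)$. A Coxeter element of $G(d,d,m)$ is an element whose order is the largest degree $h$ of $G(d,d,m)$ (the largest degree in a system of algebraically independent homogeneous generators of its algebra of invariant polynomials) and which has an eigenvector, with some $h$-th root of unity as eigenvalue, lying in no reflecting hyperplane. For each $m$ fix any Coxeter element $c_m$, let $NC(G(d,d,m))$ be the poset of all $u$ with $1\le_T u\le_T c_m$, ordered by $\le_T$, and let $r_k(d,m)$ be the number of its elements of rank $k$ (the rank of $x$ being the length of a longest chain with greatest element $x$). Then $r_k(d,n)=0$ for $k>n$, so that the rank-generating polynomial of $NC(G(d,d,n))$ is $r_0(d,n)+r_1(d,n)t+\cdots+r_n(d,n)t^n$. Moreover $r_0(d,n)=1=r_n(d,n)$ and $r_1(d,n)=(n-1)(n+d-2)=r_{n-1}(d,n)$,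 and for $k\in\{2,3,\ldots,n-2\}$ \begin{align*} r_k(d,n) &= r_k(d,n-1)+r_{k-1}(d,n-1)\\ &\quad + 2\sum_{i=1}^{n-3}\sum_{j=0}^{k-1}\frac{r_j(d,n-i-1)}{i}\binom{i}{k-j}\binom{i}{k-j-1}\\ &\quad + \binom{n-2}{k-1}\left(\frac{d}{k}\binom{n-1}{k-1}+\frac{1}{n-2}\left(\binom{n-2}{k-2}+\binom{n-2}{k}\right)\right). \end{align*} -/

import Mathlib

/-! ### Complex reflection groups -/

/-- A group of unitary transformations of `ℂⁿ`, in matrix form. -/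
abbrev UnitarySubgroup (n : ℕ) : Type := Subgroup (Matrix.unitaryGroup (Fin n) ℂ)

/-- The subspace of `ℂⁿ` fixed by a unitary matrix. -/
noncomputable def fixedSpace {n : ℕ} (w : Matrix.unitaryGroup (Fin n) ℂ) :
    Submodule ℂ (Fin n → ℂ) :=
  LinearMap.ker (Matrix.toLin' (w : Matrix (Fin n) (Fin n) ℂ) - LinearMap.id)

/-- A reflection: a unitary matrix of finite order whose fixed space has codimension `1`. -/
def IsReflection {n : ℕ} (t : Matrix.unitaryGroup (Fin n) ℂ) : Prop :=
  IsOfFinOrder t ∧ Module.finrank ℂ (fixedSpace t) + 1 = n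

/-- A vector is regular for `W` if it lies on no reflecting hyperplane of `W`. -/
def IsRegularVector {n : ℕ} (W : UnitarySubgroup n) (v : Fin n → ℂ) : Prop :=
  ∀ t ∈ W, IsReflection t → v ∉ fixedSpace t

/-- `w` is `ζ`-regular: `ζ` is an eigenvalue of `w` with a regular eigenvector. -/
def IsRegularElement {n : ℕ} (W : UnitarySubgroup n) (ζ : ℂ)
    (w : Matrix.unitaryGroup (Fin n) ℂ) : Prop :=
  ∃ v : Fin n → ℂ,
    Module.End.HasEigenvector (Matrix.toLin' (w : Matrix (Fin n) (Fin n) ℂ)) ζ v ∧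
      IsRegularVector W v

/-- `f` is invariant under `W`: `f (w x) = f x` for all `w ∈ W`. -/
def IsInvariantPolynomial {n : ℕ} (W : UnitarySubgroup n) (f : MvPolynomial (Fin n) ℂ) : Prop :=
  ∀ w ∈ W, MvPolynomial.aeval
    (fun i => ∑ j, MvPolynomial.C ((w : Matrix (Fin n) (Fin n) ℂ) i j) * MvPolynomial.X j) f = f

/-- `δ` lists the degrees of `W`: the degrees of algebraically independent homogeneous
generators of the algebra of `W`-invariant polynomials. -/
def IsDegrees {n : ℕ} (W : UnitarySubgroup n) (δ : Fin n → ℕ) : Prop :=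
  ∃ f : Fin n → MvPolynomial (Fin n) ℂ,
    AlgebraicIndependent ℂ f ∧ (∀ i, (f i).IsHomogeneous (δ i)) ∧
      ∀ g : MvPolynomial (Fin n) ℂ,
        g ∈ Algebra.adjoin ℂ (Set.range f) ↔ IsInvariantPolynomial W g

/-- `h` is the Coxeter number of `W`: its largest degree. -/
def IsCoxeterNumber {n : ℕ} (W : UnitarySubgroup n) (h : ℕ) : Prop :=
  ∃ δ : Fin n → ℕ, IsDegrees W δ ∧ IsGreatest (Set.range δ) h

/-- A Coxeter element of `W`: a `ζ`-regular element of order `h`, for some `h`-th root of unity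
`ζ`, where `h` is the Coxeter number of `W`. -/
def IsCoxeterElement {n : ℕ} (W : UnitarySubgroup n) (c : W) : Prop :=
  ∃ h : ℕ, IsCoxeterNumber W h ∧ orderOf c = h ∧
    ∃ ζ : ℂ, ζ ^ h = 1 ∧ IsRegularElement W ζ c

/-! ### Noncrossing partitions -/

/-- The absolute length `ℓ_T(w)`: the least length of a factorization of `w` into reflections of
`W` (it would be `⊤` for an element that is no product of reflections; there is none if `W` is
generated by its reflections). -/
noncomputable def absLength {n : ℕ} (W : UnitarySubgroup n) (w : W) : ℕ∞ :=
  sInf {k : ℕ∞ | ∃ l : List W,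
    (∀ t ∈ l, IsReflection (t : Matrix.unitaryGroup (Fin n) ℂ)) ∧ l.prod = w ∧
      k = (l.length : ℕ∞)}

/-- The absolute order `u ≤_T v` on `W`. -/
def AbsLE {n : ℕ} (W : UnitarySubgroup n) (u v : W) : Prop :=
  absLength W v = absLength W u + absLength W (u⁻¹ * v)

theorem absLength_one {n : ℕ} (W : UnitarySubgroup n) : absLength W 1 = 0 := by
  refine le_antisymm (sInf_le ⟨[], by simp, by simp, by simp⟩) (zero_le)

theorem absLength_mul_le {n : ℕ} (W : UnitarySubgroup n) (u v : W) :
    absLength W (u * v) ≤ absLength W u + absLength W v := by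
  have key : ∀ w : W, absLength W w = ⊤ ∨ ∃ l : List W,
      (∀ t ∈ l, IsReflection (t : Matrix.unitaryGroup (Fin n) ℂ)) ∧ l.prod = w ∧
        absLength W w = (l.length : ℕ∞) := by
    intro w
    rcases Set.eq_empty_or_nonempty {k : ℕ∞ | ∃ l : List W,
      (∀ t ∈ l, IsReflection (t : Matrix.unitaryGroup (Fin n) ℂ)) ∧ l.prod = w ∧
        k = (l.length : ℕ∞)} with h | h
    · left
      rw [absLength, h, sInf_empty]
    · right
      exact csInf_mem h
  rcases key u with hu | ⟨l, hl, rfl, hu⟩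
  · simp [hu]
  rcases key v with hv | ⟨m, hm, rfl, hv⟩
  · simp [hv]
  rw [hu, hv]
  refine sInf_le ⟨l ++ m, ?_, by simp, by simp⟩
  intro t ht
  rcases List.mem_append.1 ht with h | h
  · exact hl t h
  · exact hm t h

/-- The set of `W`-noncrossing partitions with respect to `c`. -/
def NCPartition {n : ℕ} (W : UnitarySubgroup n) (c : W) : Type :=
  {u : W // AbsLE W 1 u ∧ AbsLE W u c}

/-- `W`-noncrossing partitions are ordered by the absolute order (which is antisymmetric when
`W` is generated by its reflections). -/
instance {n : ℕ} (W : UnitarySubgroup n) (c : W) : Preorder (NCPartition W c) where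
  le x y := AbsLE W x.1 y.1
  le_refl x := by simp [AbsLE, absLength_one]
  le_trans x y z hxy hyz := by
    unfold AbsLE at *
    apply le_antisymm
    · calc absLength W z.1 = absLength W (x.1 * (x.1⁻¹ * z.1)) := by simp
        _ ≤ _ := absLength_mul_le W _ _
    · rw [hyz, hxy, add_assoc]
      gcongr
      calc absLength W (x.1⁻¹ * z.1) = absLength W ((x.1⁻¹ * y.1) * (y.1⁻¹ * z.1)) := by
            simp [mul_assoc]
        _ ≤ _ := absLength_mul_le W _ _

/-- The `k`-th rank number of a graded poset with least element: the number of elements `x` of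
rank `k`, the rank of `x` being the length of a longest chain with greatest element `x`. -/
noncomputable def rankNumber (P : Type*) [Preorder P] (k : ℕ) : ℕ :=
  Nat.card {x : P // Order.height x = (k : ℕ∞)}

/-! ### The groups `G(d,d,n)` -/

/-- The monomial matrix with entry `a j` in position `(σ j, j)` and `0` elsewhere. -/
def monomialMatrix {n : ℕ} (σ : Equiv.Perm (Fin n)) (a : Fin n → ℂ) :
    Matrix (Fin n) (Fin n) ℂ :=
  Matrix.of fun i j => if i = σ j then a j else 0

/-- The group `G(d,d,n)`: monomial `n × n` matrices whose nonzero entries are `d`-th roots of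
unity with product `1`. -/
def groupGddn (d n : ℕ) : UnitarySubgroup n where
  carrier := {w | ∃ (σ : Equiv.Perm (Fin n)) (a : Fin n → ℂ),
    (∀ j, a j ^ d = 1) ∧ ∏ j, a j = 1 ∧
      (w : Matrix (Fin n) (Fin n) ℂ) = monomialMatrix σ a}
  one_mem' := by
    refine ⟨1, fun _ => 1, by simp, by simp, ?_⟩
    ext i j
    simp only [monomialMatrix, Matrix.one_apply, OneMemClass.coe_one, Matrix.of_apply,
      Equiv.Perm.coe_one, id_eq]
    split_ifs <;> simp_all
  mul_mem' := by
    rintro w w' ⟨σ, a, ha, ha', hw⟩ ⟨τ, b, hb, hb', hw'⟩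
    refine ⟨σ * τ, fun j => a (τ j) * b j, ?_, ?_, ?_⟩
    · intro j
      rw [mul_pow, ha, hb, one_mul]
    · rw [Finset.prod_mul_distrib, hb', mul_one, Equiv.prod_comp τ a, ha']
    · ext i j
      simp [hw, hw', monomialMatrix, Matrix.mul_apply]
      split_ifs <;> simp_all
  inv_mem' := by
    rintro w ⟨σ, a, ha, ha', hw⟩
    have h0 : ∀ j, a j ≠ 0 := fun j hj =>
      Finset.prod_ne_zero_iff.1 (ha'.trans_ne one_ne_zero) j (Finset.mem_univ j) hj
    refine ⟨σ⁻¹, fun j => (a (σ⁻¹ j))⁻¹, ?_, ?_, ?_⟩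
    · intro j
      rw [inv_pow, ha, inv_one]
    · rw [Finset.prod_inv_distrib, Equiv.prod_comp σ⁻¹ a, ha', inv_one]
    · have h1 : (w : Matrix (Fin n) (Fin n) ℂ) *
          monomialMatrix σ⁻¹ (fun j => (a (σ⁻¹ j))⁻¹) = 1 := by
        rw [hw]
        ext i j
        simp [monomialMatrix, Matrix.mul_apply, Matrix.one_apply, h0]
      have h2 : ((w⁻¹ : Matrix.unitaryGroup (Fin n) ℂ) : Matrix (Fin n) (Fin n) ℂ) *
          (w : Matrix (Fin n) (Fin n) ℂ) = 1 := by
        simp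
      exact left_inv_eq_right_inv h2 h1

/-! Elements of `G(d,d,n)` are weighted permutations of total weight 1. With N = n - 1, a Coxeter
element c is a cycle through N basis vectors together with one line spanned by e_b that it
preserves, of inverse weights different from 1 (`exists_isCoxeterLike`). Below such an element the
absolute order is the order given by the codimension of fixed spaces (`absLE_iff`), and the rank is
the codimension (`height_eq`). So one counts, by codimension, the u of weight 1 with codim u + codim
(u⁻¹c) = codim c.

The count splits by the image of e_b (`genOf_weight`). If u fixes e_b, then u lies below a cycle of
length N and nontrivial weight: this gives `narQ N`. If u multiplies e_b by a nontrivial scalar, the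
Kreweras complement u⁻¹c fixes e_b: this gives the reversal of `narQ N`. If u sends e_b to a
multiple of another e_m, there are N choices of m and d of the scalar; splitting off a reflection
leaves a cycle of length N and weight 1, which gives N d X `narP N`. The polynomials `narP` and
`narQ` of cycles come from the same device: the image of the head of a cycle determines a reflection
that cuts the cycle in two (`gen_eq`, `gen_cyc`).

The series of the `narP` satisfies a quadratic equation, hence a differential equation, hence a
three-term recurrence, which yields the Narayana numbers (`coeff_narP`). Finally `narQ N`, its
reversal and N `narP N` satisfy the same convolution recursion up to their inhomogeneous terms.
Their combination gives `rankPoly_recurrence`, and comparing coefficients gives the claim; the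
symmetry `reflect_rankPoly` settles the top ranks. -/

/-! ### Weighted permutations -/

/-- A monomial transformation, given by a permutation and the weights of its columns. -/
@[ext]
structure WeightedPerm (ι : Type*) (A : Subgroup ℂˣ) where
  perm : Equiv.Perm ι
  wt : ι → A

namespace WeightedPerm

variable {ι : Type*} {A : Subgroup ℂˣ}

instance : Mul (WeightedPerm ι A) :=
  ⟨fun u v => ⟨u.perm * v.perm, fun j => u.wt (v.perm j) * v.wt j⟩⟩

instance : One (WeightedPerm ι A) := ⟨⟨1, fun _ => 1⟩⟩

instance : Inv (WeightedPerm ι A) :=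
  ⟨fun u => ⟨u.perm⁻¹, fun j => (u.wt (u.perm⁻¹ j))⁻¹⟩⟩

@[simp] theorem mul_perm (u v : WeightedPerm ι A) : (u * v).perm = u.perm * v.perm := rfl
@[simp] theorem mul_wt (u v : WeightedPerm ι A) (j : ι) :
    (u * v).wt j = u.wt (v.perm j) * v.wt j := rfl
@[simp] theorem one_perm : (1 : WeightedPerm ι A).perm = 1 := rfl
@[simp] theorem one_wt (j : ι) : (1 : WeightedPerm ι A).wt j = 1 := rfl
@[simp] theorem inv_perm (u : WeightedPerm ι A) : (u⁻¹).perm = u.perm⁻¹ := rfl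
@[simp] theorem inv_wt (u : WeightedPerm ι A) (j : ι) :
    (u⁻¹).wt j = (u.wt (u.perm⁻¹ j))⁻¹ := rfl

instance : Group (WeightedPerm ι A) :=
  Group.ofLeftAxioms
    (fun u v w => by ext1 <;> [rfl; (funext j; simp [mul_assoc])])
    (fun u => by ext1 <;> [rfl; (funext j; simp)])
    (fun u => by ext1 <;> [simp; (funext j; simp)])

noncomputable instance [Fintype ι] [Fintype A] : Fintype (WeightedPerm ι A) := by
  classical
  exact Fintype.ofInjective (fun w : WeightedPerm ι A => (w.perm, w.wt)) (by
    rintro ⟨a, b⟩ ⟨c, e⟩ h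
    simpa using h)

/-- The underlying permutation, as a homomorphism. -/
def permHom : WeightedPerm ι A →* Equiv.Perm ι where
  toFun := perm
  map_one' := rfl
  map_mul' _ _ := rfl

/-- A permutation, with all weights `1`. -/
def ofPerm : Equiv.Perm ι →* WeightedPerm ι A where
  toFun σ := ⟨σ, fun _ => 1⟩
  map_one' := rfl
  map_mul' _ _ := by ext1 <;> [rfl; (funext j; simp)]

@[simp] theorem ofPerm_perm (σ : Equiv.Perm ι) : (ofPerm σ : WeightedPerm ι A).perm = σ := rfl
@[simp] theorem ofPerm_wt (σ : Equiv.Perm ι) (j : ι) :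
    (ofPerm σ : WeightedPerm ι A).wt j = 1 := rfl

/-- Forget the weights. -/
def abs : WeightedPerm ι A →* WeightedPerm ι A := ofPerm.comp permHom

@[simp] theorem abs_perm (w : WeightedPerm ι A) : (abs w).perm = w.perm := rfl
@[simp] theorem abs_wt (w : WeightedPerm ι A) (j : ι) : (abs w).wt j = 1 := rfl

/-- The product of the weights. -/
def weight [Fintype ι] : WeightedPerm ι A →* A where
  toFun w := ∏ j, w.wt j
  map_one' := by simp
  map_mul' u v := by
    simp only [mul_wt, Finset.prod_mul_distrib]
    rw [Equiv.prod_comp v.perm u.wt]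

theorem weight_apply [Fintype ι] (w : WeightedPerm ι A) : weight w = ∏ j, w.wt j := rfl

/-- The basis vector with index `j` is fixed. -/
def FixesPt (w : WeightedPerm ι A) (j : ι) : Prop := w.perm j = j ∧ w.wt j = 1

theorem FixesPt.mul {u v : WeightedPerm ι A} {j : ι} (hu : u.FixesPt j) (hv : v.FixesPt j) :
    (u * v).FixesPt j := by
  simp [FixesPt, hu.1, hu.2, hv.1, hv.2]

theorem FixesPt.inv {u : WeightedPerm ι A} {j : ι} (hu : u.FixesPt j) : (u⁻¹).FixesPt j := by
  have : u.perm⁻¹ j = j := by rw [Equiv.Perm.inv_eq_iff_eq]; exact hu.1.symm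
  simp [FixesPt, this, hu.2]

theorem fixesPt_one (j : ι) : (1 : WeightedPerm ι A).FixesPt j := ⟨rfl, rfl⟩

theorem eq_one_of_fixesPt {u : WeightedPerm ι A} (h : ∀ j, u.FixesPt j) : u = 1 := by
  ext1
  · ext j; exact (h j).1
  · funext j; exact (h j).2

/-! ### Fixed spaces, their codimension, and the order by codimension. -/

/-- The fixed space of the transformation `e_j ↦ wt j • e_(perm j)` of `ι → ℂ`. -/
def fixSub (w : WeightedPerm ι A) : Submodule ℂ (ι → ℂ) where
  carrier := {x | ∀ j, x (w.perm j) = ((w.wt j : ℂˣ) : ℂ) * x j}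
  zero_mem' := by simp
  add_mem' := by
    intro x y hx hy j
    simp only [Pi.add_apply, mul_add, hx j, hy j]
  smul_mem' := by
    intro a x hx j
    simp only [Pi.smul_apply, smul_eq_mul, hx j]
    ring

theorem mem_fixSub {w : WeightedPerm ι A} {x : ι → ℂ} :
    x ∈ fixSub w ↔ ∀ j, x (w.perm j) = ((w.wt j : ℂˣ) : ℂ) * x j := Iff.rfl

theorem inf_fixSub_le (u v : WeightedPerm ι A) : fixSub u ⊓ fixSub v ≤ fixSub (u * v) := by
  rintro x ⟨hu, hv⟩ j
  simp only [mul_perm, Equiv.Perm.coe_mul, Function.comp_apply, mul_wt, Subgroup.coe_mul,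
    Units.val_mul]
  rw [hu (v.perm j), hv j, mul_assoc]

theorem fixSub_inv (u : WeightedPerm ι A) : fixSub u⁻¹ = fixSub u := by
  have key : ∀ u : WeightedPerm ι A, fixSub u ≤ fixSub u⁻¹ := by
    intro u x hx j
    have := hx (u.perm⁻¹ j)
    have hi : u.perm (u.perm⁻¹ j) = j := by simp
    rw [hi] at this
    have hz : ((u.wt (u.perm⁻¹ j) : ℂˣ) : ℂ) ≠ 0 := Units.ne_zero _
    rw [inv_perm, inv_wt, this, InvMemClass.coe_inv, Units.val_inv_eq_inv_val,
      inv_mul_cancel_left₀ hz]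
  exact le_antisymm (by simpa using key u⁻¹) (key u)

@[simp] theorem fixSub_one : fixSub (1 : WeightedPerm ι A) = ⊤ := by
  ext x; simp [mem_fixSub]

/-- The linear action, on functions. -/
def act (g : WeightedPerm ι A) (x : ι → ℂ) : ι → ℂ :=
  fun i => ((g.wt (g.perm⁻¹ i) : ℂˣ) : ℂ) * x (g.perm⁻¹ i)

theorem act_perm (g : WeightedPerm ι A) (x : ι → ℂ) (j : ι) :
    act g x (g.perm j) = ((g.wt j : ℂˣ) : ℂ) * x j := by
  simp [act]

theorem act_mem_fixSub {g u : WeightedPerm ι A} {x : ι → ℂ} (hx : x ∈ fixSub u) :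
    act g x ∈ fixSub (g * u * g⁻¹) := by
  intro i
  obtain ⟨j, rfl⟩ := g.perm.surjective i
  have h1 : (g * u * g⁻¹).perm (g.perm j) = g.perm (u.perm j) := by simp
  rw [h1, act_perm, act_perm, hx j]
  have hi : g.perm⁻¹ (g.perm j) = j := by simp
  simp only [inv_perm, mul_wt, inv_wt, hi, Subgroup.coe_mul, Units.val_mul,
    InvMemClass.coe_inv]
  have : ((g.wt j : ℂˣ) : ℂ) ≠ 0 := Units.ne_zero _
  rw [Units.val_inv_eq_inv_val]
  field_simp

theorem single_mem_fixSub [DecidableEq ι] {w : WeightedPerm ι A} {j : ι} :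
    (Pi.single j 1 : ι → ℂ) ∈ fixSub w ↔ w.FixesPt j := by
  constructor
  · intro h
    have h1 := h j
    have hp : w.perm j = j := by
      by_contra hne
      rw [Pi.single_eq_of_ne hne, Pi.single_eq_same, mul_one] at h1
      exact Units.ne_zero _ h1.symm
    refine ⟨hp, ?_⟩
    rw [hp, Pi.single_eq_same, mul_one] at h1
    ext
    simp [← h1]
  · rintro ⟨hp, hw⟩ i
    by_cases hi : i = j
    · subst hi; simp [hp, hw]
    · have : w.perm i ≠ j := fun h => hi (w.perm.injective (h.trans hp.symm))
      simp [this, hi]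

variable [Fintype ι]

open Module

/-- The codimension of the fixed space. -/
noncomputable def codim (w : WeightedPerm ι A) : ℕ := Fintype.card ι - finrank ℂ (fixSub w)

theorem codim_add_finrank (w : WeightedPerm ι A) :
    codim w + finrank ℂ (fixSub w) = Fintype.card ι := by
  have := Submodule.finrank_le (fixSub w)
  rw [finrank_fintype_fun_eq_card] at this
  unfold codim
  omega

@[simp] theorem codim_one : codim (1 : WeightedPerm ι A) = 0 := by
  have := codim_add_finrank (1 : WeightedPerm ι A)
  rw [fixSub_one, finrank_top, finrank_fintype_fun_eq_card] at this
  omega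

theorem codim_inv (u : WeightedPerm ι A) : codim u⁻¹ = codim u := by
  rw [codim, fixSub_inv, codim]

/-- The fixed space of a product contains the intersection of the fixed spaces; the dimension
formula does the rest. -/
theorem codim_mul_le (u v : WeightedPerm ι A) : codim (u * v) ≤ codim u + codim v := by
  have h1 := Submodule.finrank_mono (inf_fixSub_le u v)
  have h2 := Submodule.finrank_sup_add_finrank_inf_eq (fixSub u) (fixSub v)
  have h3 := Submodule.finrank_le (fixSub u ⊔ fixSub v)
  rw [finrank_fintype_fun_eq_card] at h3
  have := codim_add_finrank u
  have := codim_add_finrank v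
  have := codim_add_finrank (u * v)
  omega

theorem codim_conj (g u : WeightedPerm ι A) : codim (g * u * g⁻¹) = codim u := by
  have key : ∀ g u : WeightedPerm ι A, codim (g * u * g⁻¹) ≤ codim u := by
    intro g u
    let f : fixSub u →ₗ[ℂ] fixSub (g * u * g⁻¹) :=
      { toFun := fun x => ⟨act g x, act_mem_fixSub x.2⟩
        map_add' := fun x y => by ext i; simp [act, mul_add]
        map_smul' := fun a x => by ext i; simp [act]; ring }
    have hf : Function.Injective f := by
      intro x y hxy
      ext j
      have := congrFun (congrArg Subtype.val hxy) (g.perm j)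
      simpa [f, act_perm] using this
    have := LinearMap.finrank_le_finrank_of_injective hf
    have := codim_add_finrank u
    have := codim_add_finrank (g * u * g⁻¹)
    omega
  refine le_antisymm (key g u) ?_
  have := key g⁻¹ (g * u * g⁻¹)
  simpa [mul_assoc] using this

theorem codim_mul_comm (u v : WeightedPerm ι A) : codim (u * v) = codim (v * u) := by
  have := codim_conj v (u * v)
  simpa [mul_assoc] using this.symm

theorem codim_eq_zero {u : WeightedPerm ι A} (h : codim u = 0) : u = 1 := by
  classical
  have h1 := codim_add_finrank u
  rw [h, zero_add] at h1
  have h2 : fixSub u = ⊤ := Submodule.eq_top_of_finrank_eq (by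
    rw [h1, finrank_fintype_fun_eq_card])
  exact eq_one_of_fixesPt fun j => single_mem_fixSub.1 (by rw [h2]; trivial)

/-- The order by codimension. -/
def CodimLE (u c : WeightedPerm ι A) : Prop := codim u + codim (u⁻¹ * c) = codim c

theorem codim_le_add (u c : WeightedPerm ι A) : codim c ≤ codim u + codim (u⁻¹ * c) := by
  simpa using codim_mul_le u (u⁻¹ * c)

/-- Equality in `codim_mul_le` is possible only if the two fixed spaces are transverse. -/
theorem CodimLE.sup_eq_top {u c : WeightedPerm ι A} (h : CodimLE u c) :
    fixSub u ⊔ fixSub (u⁻¹ * c) = ⊤ := by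
  have h1 := Submodule.finrank_mono (inf_fixSub_le u (u⁻¹ * c))
  rw [mul_inv_cancel_left] at h1
  have h2 := Submodule.finrank_sup_add_finrank_inf_eq (fixSub u) (fixSub (u⁻¹ * c))
  have h4 := codim_add_finrank u
  have h5 := codim_add_finrank (u⁻¹ * c)
  have h6 := codim_add_finrank c
  unfold CodimLE at h
  have h3 := Submodule.finrank_le (fixSub u ⊔ fixSub (u⁻¹ * c))
  rw [finrank_fintype_fun_eq_card] at h3
  refine Submodule.eq_top_of_finrank_eq ?_
  rw [finrank_fintype_fun_eq_card]
  omega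

/-- Equality in the dimension count makes the fixed space of c exactly the intersection of those of
u and u⁻¹c. -/
theorem CodimLE.fixSub_le {u c : WeightedPerm ι A} (h : CodimLE u c) : fixSub c ≤ fixSub u := by
  have h1 := inf_fixSub_le u (u⁻¹ * c)
  rw [mul_inv_cancel_left] at h1
  have h2 := Submodule.finrank_sup_add_finrank_inf_eq (fixSub u) (fixSub (u⁻¹ * c))
  have h3 := Submodule.finrank_le (fixSub u ⊔ fixSub (u⁻¹ * c))
  rw [finrank_fintype_fun_eq_card] at h3
  have h4 := codim_add_finrank u
  have h5 := codim_add_finrank (u⁻¹ * c)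
  have h6 := codim_add_finrank c
  unfold CodimLE at h
  have h7 := Submodule.eq_of_le_of_finrank_le h1 (by omega)
  rw [← h7]
  exact inf_le_left

theorem CodimLE.fixesPt {u c : WeightedPerm ι A} (h : CodimLE u c) {j : ι} (hc : c.FixesPt j) :
    u.FixesPt j := by
  classical
  exact single_mem_fixSub.1 (h.fixSub_le (single_mem_fixSub.2 hc))

/-- The complement of u⁻¹c in c is c⁻¹uc, a conjugate of u. -/
theorem CodimLE.kreweras {u c : WeightedPerm ι A} (h : CodimLE u c) : CodimLE (u⁻¹ * c) c := by
  unfold CodimLE at *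
  rw [← h, add_comm]
  congr 1
  have : (u⁻¹ * c)⁻¹ * c = c⁻¹ * u * c⁻¹⁻¹ := by group
  rw [this, codim_conj]

theorem codimLE_conj {u c : WeightedPerm ι A} (g : WeightedPerm ι A) :
    CodimLE (g * u * g⁻¹) (g * c * g⁻¹) ↔ CodimLE u c := by
  unfold CodimLE
  have : (g * u * g⁻¹)⁻¹ * (g * c * g⁻¹) = g * (u⁻¹ * c) * g⁻¹ := by group
  rw [this, codim_conj, codim_conj, codim_conj]

/-! ### Reflections moving a given basis vector -/

section Refl

variable [DecidableEq ι]

/-- The transformation of codimension at most `1` which maps `z • e_m` to `e_x`. -/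
def refl (x m : ι) (z : A) : WeightedPerm ι A :=
  ⟨Equiv.swap x m, fun j => if j = m then z⁻¹ else if j = x then z else 1⟩

omit [Fintype ι] in
@[simp] theorem refl_perm (x m : ι) (z : A) : (refl x m z).perm = Equiv.swap x m := rfl
omit [Fintype ι] in
theorem refl_wt (x m : ι) (z : A) (j : ι) :
    (refl x m z).wt j = if j = m then z⁻¹ else if j = x then z else 1 := rfl

/-- Multiplication by the reflection that makes `e_x` fixed. -/
def drop (x : ι) (w : WeightedPerm ι A) : WeightedPerm ι A := refl x (w.perm x) (w.wt x) * w

omit [Fintype ι] in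
theorem refl_self_one (x : ι) : (refl x x 1 : WeightedPerm ι A) = 1 := by
  ext1
  · simp [Equiv.Perm.one_def]
  · funext j; simp [refl_wt]

omit [Fintype ι] in
theorem refl_mul_self {x m : ι} (h : x ≠ m) (z : A) : refl x m z * refl x m z = 1 := by
  ext1
  · simp
  · funext j
    by_cases h1 : j = m
    · subst h1; simp [refl_wt, h]
    · by_cases h2 : j = x
      · subst h2; simp [refl_wt, h]
      · simp [refl_wt, h1, h2, Equiv.swap_apply_of_ne_of_ne h2 h1]

omit [Fintype ι] in
theorem mem_fixSub_refl {x m : ι} {z : A} {y : ι → ℂ} (h : y m = ((z : ℂˣ) : ℂ) * y x) :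
    y ∈ fixSub (refl x m z) := by
  have hz : ((z : ℂˣ) : ℂ) ≠ 0 := Units.ne_zero _
  intro j
  simp only [refl_perm, refl_wt]
  by_cases h1 : j = m
  · subst h1
    simp [h, Units.val_inv_eq_inv_val, hz]
  · by_cases h2 : j = x
    · subst h2; simp [h1, h]
    · simp [h1, h2, Equiv.swap_apply_of_ne_of_ne h2 h1]

theorem codim_refl_le (x m : ι) (z : A) : codim (refl x m z) ≤ 1 := by
  let φ : (ι → ℂ) →ₗ[ℂ] ℂ := LinearMap.proj m - ((z : ℂˣ) : ℂ) • LinearMap.proj x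
  have h1 : LinearMap.ker φ ≤ fixSub (refl x m z) := by
    intro y hy
    refine mem_fixSub_refl ?_
    have : y m - ((z : ℂˣ) : ℂ) * y x = 0 := hy
    linear_combination this
  have h2 := Submodule.finrank_mono h1
  have h3 := LinearMap.finrank_range_add_finrank_ker φ
  have h4 := Submodule.finrank_le (LinearMap.range φ)
  rw [finrank_fintype_fun_eq_card] at h3
  rw [finrank_self] at h4
  have h5 := codim_add_finrank (refl x m z)
  omega

theorem codim_le_refl_mul (x m : ι) (z : A) (w : WeightedPerm ι A) :
    codim w ≤ codim (refl x m z * w) + 1 := by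
  have h1 := codim_mul_le (refl x m z)⁻¹ (refl x m z * w)
  rw [inv_mul_cancel_left, codim_inv] at h1
  have := codim_refl_le x m z
  omega

omit [Fintype ι] in
theorem drop_fixesPt (x : ι) (w : WeightedPerm ι A) : (drop x w).FixesPt x := by
  simp [FixesPt, drop, refl_wt]

omit [Fintype ι] in
theorem drop_of_fixesPt {x : ι} {w : WeightedPerm ι A} (h : w.FixesPt x) : drop x w = w := by
  rw [drop, h.1, h.2, refl_self_one, one_mul]

omit [Fintype ι] in
theorem fixSub_le_drop (x : ι) (w : WeightedPerm ι A) : fixSub w ≤ fixSub (drop x w) :=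
  fun _ hy => inf_fixSub_le _ _ ⟨mem_fixSub_refl (hy x), hy⟩

/-- One reflection changes the codimension by at most 1, and here the fixed space grows strictly
because it gains e_x. -/
theorem codim_drop {x : ι} {w : WeightedPerm ι A} (h : ¬ w.FixesPt x) :
    codim (drop x w) + 1 = codim w := by
  have h1 : fixSub w < fixSub (drop x w) := by
    refine lt_of_le_of_ne (fixSub_le_drop x w) fun he => h ?_
    rw [← single_mem_fixSub, he, single_mem_fixSub]
    exact drop_fixesPt x w
  have h2 := Submodule.finrank_lt_finrank_of_lt h1
  have h3 := codim_le_refl_mul x (w.perm x) (w.wt x) w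
  have h4 := codim_add_finrank w
  have h5 := codim_add_finrank (drop x w)
  unfold drop at *
  omega

omit [Fintype ι] in
-- Conjugating by u, which fixes e_x, moves only the other vector of the reflection. This carries
-- the reflection in `drop` past u.
theorem refl_mul_of_fixesPt {x : ι} {u : WeightedPerm ι A} (hu : u.FixesPt x) (m : ι) (z : A) :
    refl x (u.perm m) (u.wt m * z) * u = u * refl x m z := by
  ext1
  · ext j
    simp only [mul_perm, refl_perm, Equiv.Perm.coe_mul, Function.comp_apply]
    conv_lhs => rw [← hu.1]
    rw [Equiv.swap_apply_apply]
    simp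
  · funext j
    simp only [mul_wt, refl_wt, refl_perm]
    have hx : u.perm j = x ↔ j = x :=
      ⟨fun h => u.perm.injective (h.trans hu.1.symm), fun h => h ▸ hu.1⟩
    by_cases h1 : j = m
    · subst h1
      simp [hu.2, mul_comm]
    · by_cases h2 : j = x
      · subst h2
        have h3 : u.perm j ≠ u.perm m := fun h => h1 (u.perm.injective h)
        have h4 : j ≠ u.perm m := fun h => h3 (hu.1.trans h)
        simp [h1, h4, hu.1, hu.2]
      · simp [h1, h2, hx, Equiv.swap_apply_of_ne_of_ne h2 h1]

/-- The elements below `c` which fix `e_x` are those below `drop x c`. -/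
theorem codimLE_drop_iff {x : ι} {u c : WeightedPerm ι A} :
    CodimLE u (drop x c) ↔ CodimLE u c ∧ u.FixesPt x := by
  by_cases hc : c.FixesPt x
  · rw [drop_of_fixesPt hc]
    exact ⟨fun h => ⟨h, h.fixesPt hc⟩, fun h => h.1⟩
  have hd := codim_drop hc
  constructor
  · intro h
    have hu := h.fixesPt (drop_fixesPt x c)
    refine ⟨?_, hu⟩
    have h1 := codim_le_add u c
    have h2 : codim (u⁻¹ * c) ≤ codim (u⁻¹ * drop x c) + 1 := by
      have := codim_mul_le (u⁻¹ * (refl x (c.perm x) (c.wt x))⁻¹ * u⁻¹⁻¹) (u⁻¹ * drop x c)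
      rw [codim_conj, codim_inv] at this
      have h3 : u⁻¹ * (refl x (c.perm x) (c.wt x))⁻¹ * u⁻¹⁻¹ * (u⁻¹ * drop x c) = u⁻¹ * c := by
        unfold drop; group
      rw [h3] at this
      have := codim_refl_le x (c.perm x) (c.wt x)
      omega
    unfold CodimLE at *
    omega
  · rintro ⟨h, hu⟩
    have hv : ¬ (u⁻¹ * c).FixesPt x := fun hv => hc (by simpa using hu.mul hv)
    -- The reflection that drops x from u⁻¹c is the u-conjugate of the one that drops x from c.
    have h1 : drop x (u⁻¹ * c) = u⁻¹ * drop x c := by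
      have h2 := refl_mul_of_fixesPt hu ((u⁻¹ * c).perm x) ((u⁻¹ * c).wt x)
      have h3 : u.perm ((u⁻¹ * c).perm x) = c.perm x := by simp
      have h4 : u.wt ((u⁻¹ * c).perm x) * (u⁻¹ * c).wt x = c.wt x := by
        rw [← mul_wt, mul_inv_cancel_left]
      rw [h3, h4] at h2
      rw [drop, eq_inv_mul_iff_mul_eq, ← mul_assoc, ← h2, drop]
      simp [mul_assoc]
    have h5 := codim_drop hv
    rw [h1] at h5
    unfold CodimLE at *
    omega

/-! ### Forgetting the weights -/

omit [Fintype ι] in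
theorem abs_refl (x m : ι) (z : A) : abs (refl x m z) = refl x m 1 := by
  ext1
  · rfl
  · funext j; simp [refl_wt]

omit [Fintype ι] in
theorem abs_drop (x : ι) (u : WeightedPerm ι A) : abs (drop x u) = drop x (abs u) := by
  rw [drop, map_mul, abs_refl, drop]
  rfl

theorem codim_abs_drop {x : ι} {u : WeightedPerm ι A} (h : u.perm x ≠ x) :
    codim (abs (drop x u)) + 1 = codim (abs u) := by
  rw [abs_drop]
  exact codim_drop fun hf => h hf.1

omit [Fintype ι] [DecidableEq ι] in
theorem abs_eq_one {u : WeightedPerm ι A} (h : ∀ j, u.perm j = j) : abs u = 1 :=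
  eq_one_of_fixesPt fun j => ⟨h j, rfl⟩

/-- Dropping a moved basis vector lowers both codimensions by 1; once the permutation is trivial,
the left side is 0. What remains on the right counts the cycles of nontrivial weight. -/
theorem codim_abs_le (u : WeightedPerm ι A) : codim (abs u) ≤ codim u := by
  induction hk : codim u using Nat.strong_induction_on generalizing u with
  | _ k ih =>
    by_cases h : ∀ j, u.perm j = j
    · simp [abs_eq_one h]
    · push Not at h
      obtain ⟨x, hx⟩ := h
      have h1 := codim_drop (w := u) (x := x) fun hf => hx hf.1
      have h2 := codim_abs_drop hx
      have := ih _ (by omega) (drop x u) rfl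
      omega

/-- No cycle has a nontrivial weight. -/
def Balanced (u : WeightedPerm ι A) : Prop := codim (abs u) = codim u

theorem balanced_drop_iff {x : ι} {u : WeightedPerm ι A} (h : u.perm x ≠ x) :
    Balanced (drop x u) ↔ Balanced u := by
  have h1 := codim_drop (w := u) (x := x) fun hf => h hf.1
  have h2 := codim_abs_drop h
  unfold Balanced
  omega

theorem Balanced.wt_eq_one {u : WeightedPerm ι A} (hu : Balanced u) {x : ι} (h : u.perm x = x) :
    u.wt x = 1 := by
  by_contra hw
  have h1 := codim_drop (w := u) (x := x) fun hf => hw hf.2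
  have h2 : abs (drop x u) = abs u := by
    ext1
    · simp [drop, h, Equiv.Perm.one_def]
    · rfl
  have h3 := codim_abs_le (drop x u)
  rw [h2, hu] at h3
  omega

/-- The excess `codim w - codim (abs w)` counts the cycles of nontrivial weight. Along u and u⁻¹c
the codimensions add up exactly, while those of the unweighted permutations are only subadditive.
Hence the excess is at most 1 below a cycle and at most 2 below a Coxeter element. -/
theorem CodimLE.excess_add_le {u c : WeightedPerm ι A} (h : CodimLE u c) :
    (codim u - codim (abs u)) + (codim (u⁻¹ * c) - codim (abs (u⁻¹ * c))) ≤
      codim c - codim (abs c) := by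
  have h1 := codim_abs_le u
  have h2 := codim_abs_le (u⁻¹ * c)
  have h3 := codim_abs_le c
  have h4 := codim_mul_le (abs u) (abs (u⁻¹ * c))
  rw [← map_mul, mul_inv_cancel_left] at h4
  unfold CodimLE at h
  omega

end Refl

end WeightedPerm

namespace WeightedPerm

open Polynomial

variable {ι : Type*} {A : Subgroup ℂˣ} [Fintype ι] [DecidableEq ι]

/-! ### Disjoint supports -/

omit [Fintype ι] [DecidableEq ι] in
theorem commute_of_disjoint {L : Set ι} {u v : WeightedPerm ι A} (hu : ∀ j ∉ L, u.FixesPt j)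
    (hv : ∀ j ∈ L, v.FixesPt j) : u * v = v * u := by
  have hL : ∀ j ∈ L, u.perm j ∈ L := by
    intro j hj
    by_contra h
    have := u.perm.injective (hu _ h).1
    exact h (this.symm ▸ hj)
  have hL' : ∀ j ∉ L, v.perm j ∉ L := by
    intro j hj h
    have := v.perm.injective (hv _ h).1
    exact hj (this ▸ h)
  ext1
  · ext j
    by_cases hj : j ∈ L
    · simp [(hv j hj).1, (hv _ (hL j hj)).1]
    · simp [(hu j hj).1, (hu _ (hL' j hj)).1]
  · funext j
    by_cases hj : j ∈ L
    · simp [(hv j hj).1, (hv j hj).2, (hv _ (hL j hj)).2]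
    · simp [(hu j hj).1, (hu j hj).2, (hu _ (hL' j hj)).2]

omit [DecidableEq ι] in
-- The fixed space of the product is the intersection, and the two fixed spaces span everything,
-- since a vector splits into its parts on L and off L.
theorem codim_mul_of_disjoint {L : Set ι} {u v : WeightedPerm ι A} (hu : ∀ j ∉ L, u.FixesPt j)
    (hv : ∀ j ∈ L, v.FixesPt j) : codim (u * v) = codim u + codim v := by
  classical
  have hL : ∀ j ∈ L, u.perm j ∈ L := by
    intro j hj
    by_contra h
    have := u.perm.injective (hu _ h).1
    exact h (this.symm ▸ hj)
  have hL' : ∀ j ∉ L, v.perm j ∉ L := by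
    intro j hj h
    have := v.perm.injective (hv _ h).1
    exact hj (this ▸ h)
  have h1 : fixSub (u * v) = fixSub u ⊓ fixSub v := by
    refine le_antisymm (fun x hx => ⟨fun j => ?_, fun j => ?_⟩) (inf_fixSub_le u v)
    · by_cases hj : j ∈ L
      · have := hx j
        simpa [(hv j hj).1, (hv j hj).2] using this
      · simp [(hu j hj).1, (hu j hj).2]
    · by_cases hj : j ∈ L
      · simp [(hv j hj).1, (hv j hj).2]
      · have := hx j
        simpa [(hu _ (hL' j hj)).1, (hu _ (hL' j hj)).2] using this
  have h2 : fixSub u ⊔ fixSub v = ⊤ := by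
    refine eq_top_iff.2 fun x _ => ?_
    have hx : x = (fun j => if j ∈ L then 0 else x j) + fun j => if j ∈ L then x j else 0 := by
      funext j
      by_cases hj : j ∈ L <;> simp [hj]
    rw [hx]
    refine Submodule.add_mem_sup (fun j => ?_) (fun j => ?_)
    · by_cases hj : j ∈ L
      · simp [hj, hL j hj]
      · simp [hj, (hu j hj).1, (hu j hj).2]
    · by_cases hj : j ∈ L
      · simp [hj, (hv j hj).1, (hv j hj).2]
      · simp [hj, hL' j hj]
  have h3 := Submodule.finrank_sup_add_finrank_inf_eq (fixSub u) (fixSub v)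
  rw [h2, finrank_top, Module.finrank_fintype_fun_eq_card, ← h1] at h3
  have := codim_add_finrank u
  have := codim_add_finrank v
  have := codim_add_finrank (u * v)
  omega

omit [Fintype ι] [DecidableEq ι] in
theorem exists_mul_of_preserves {L : Set ι} {u : WeightedPerm ι A}
    (h : ∀ j, u.perm j ∈ L ↔ j ∈ L) : ∃ u₁ u₂ : WeightedPerm ι A,
      (∀ j ∉ L, u₁.FixesPt j) ∧ (∀ j ∈ L, u₂.FixesPt j) ∧ u = u₁ * u₂ := by
  classical
  let σ : Equiv.Perm ι := Equiv.Perm.ofSubtype (u.perm.subtypePerm (p := (· ∈ L)) h)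
  have hσ : ∀ j ∈ L, σ j = u.perm j := fun j hj => by
    simp [σ, Equiv.Perm.ofSubtype_apply_of_mem _ hj]
  have hσ' : ∀ j ∉ L, σ j = j := fun j hj => Equiv.Perm.ofSubtype_apply_of_not_mem _ hj
  let u₁ : WeightedPerm ι A := ⟨σ, fun j => if j ∈ L then u.wt j else 1⟩
  refine ⟨u₁, u₁⁻¹ * u, fun j hj => ⟨hσ' j hj, by simp [u₁, hj]⟩, fun j hj => ?_, by simp⟩
  have h1 : σ⁻¹ (u.perm j) = j := by rw [Equiv.Perm.inv_eq_iff_eq, hσ j hj]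
  refine ⟨h1, ?_⟩
  rw [mul_wt, inv_wt]
  change (u₁.wt (σ⁻¹ (u.perm j)))⁻¹ * _ = _
  rw [h1]
  simp [u₁, hj]

/-! ### Rank generating polynomials and their recursion. -/

variable [Fintype A]

open Classical in
/-- The rank generating polynomial of the elements below `c` with the property `R`. -/
noncomputable def genOf (R : WeightedPerm ι A → Prop) (c : WeightedPerm ι A) : ℚ[X] :=
  ∑ u : WeightedPerm ι A with CodimLE u c ∧ R u, X ^ codim u

/-- The rank generating polynomial of the balanced elements below `c`. -/
noncomputable abbrev gen (c : WeightedPerm ι A) : ℚ[X] := genOf Balanced c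

omit [DecidableEq ι] in
theorem gen_one : gen (1 : WeightedPerm ι A) = 1 := by
  classical
  have : (Finset.univ.filter fun u : WeightedPerm ι A => CodimLE u 1 ∧ Balanced u) = {1} := by
    ext u
    simp only [Finset.mem_filter, Finset.mem_univ, true_and, Finset.mem_singleton]
    constructor
    · rintro ⟨h, -⟩
      refine codim_eq_zero ?_
      rw [CodimLE, codim_one] at h
      omega
    · rintro rfl
      simp [CodimLE, Balanced]
  rw [gen, genOf]
  convert Finset.sum_singleton (fun u : WeightedPerm ι A => (X : ℚ[X]) ^ codim u) 1
  simp

omit [DecidableEq ι] [Fintype A] in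
theorem balanced_conj {g u : WeightedPerm ι A} : Balanced (g * u * g⁻¹) ↔ Balanced u := by
  unfold Balanced
  rw [map_mul, map_mul, map_inv, codim_conj, codim_conj]

omit [DecidableEq ι] in
theorem gen_conj (g c : WeightedPerm ι A) : gen (g * c * g⁻¹) = gen c := by
  symm
  refine Finset.sum_equiv (MulAut.conj g).toEquiv (fun u => ?_) (fun u _ => ?_)
  · simp [codimLE_conj, balanced_conj]
  · simp [codim_conj]

omit [Fintype A] in
-- Multiplying both u and c by the same reflection leaves u⁻¹c unchanged and lowers codim u by 1, so
-- codim c has to fall by 1 as well.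
theorem codimLE_iff_refl_mul {x : ι} {u c : WeightedPerm ι A} (h : u.perm x ≠ x) :
    CodimLE u c ↔ codim (refl x (u.perm x) (u.wt x) * c) + 1 = codim c ∧
      CodimLE (drop x u) (refl x (u.perm x) (u.wt x) * c) := by
  have h1 := codim_drop (w := u) (x := x) fun hf => h hf.1
  have h2 : (drop x u)⁻¹ * (refl x (u.perm x) (u.wt x) * c) = u⁻¹ * c := by
    unfold drop; group
  have h3 := codim_le_refl_mul x (u.perm x) (u.wt x) c
  have h4 := codim_le_add (drop x u) (refl x (u.perm x) (u.wt x) * c)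
  unfold CodimLE
  rw [h2] at *
  omega

open Classical in
-- Multiplication by the reflection is an involution. It exchanges the elements below c that send
-- e_x to z • e_m with the elements below `refl x m z * c` that fix e_x, and the latter are those
-- below its `drop`.
theorem sum_fiber {R : WeightedPerm ι A → Prop} {x m : ι} (hm : m ≠ x) (z : A)
    (hR : ∀ u : WeightedPerm ι A, u.FixesPt x → (R (refl x m z * u) ↔ R u))
    (c : WeightedPerm ι A) :
    ∑ u : WeightedPerm ι A with (CodimLE u c ∧ R u) ∧ u.perm x = m ∧ u.wt x = z,
        (X : ℚ[X]) ^ codim u =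
      if codim (refl x m z * c) + 1 = codim c then X * genOf R (drop x (refl x m z * c))
        else 0 := by
  split_ifs with hc
  · rw [genOf, Finset.mul_sum]
    refine Finset.sum_bij' (fun u _ => refl x m z * u) (fun u _ => refl x m z * u) ?_ ?_ ?_ ?_ ?_
    · intro u hu
      simp only [Finset.mem_filter, Finset.mem_univ, true_and] at hu ⊢
      obtain ⟨⟨h1, h2⟩, rfl, rfl⟩ := hu
      have hf := drop_fixesPt x u
      rw [codimLE_iff_refl_mul hm] at h1
      refine ⟨codimLE_drop_iff.2 ⟨h1.2, hf⟩, ?_⟩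
      have := hR _ hf
      rw [drop, ← mul_assoc, refl_mul_self hm.symm, one_mul] at this
      exact this.1 h2
    · intro u hu
      simp only [Finset.mem_filter, Finset.mem_univ, true_and] at hu ⊢
      obtain ⟨h1, h2⟩ := hu
      obtain ⟨h1, hf⟩ := codimLE_drop_iff.1 h1
      have hp : (refl x m z * u).perm x = m := by simp [hf.1]
      have hw : (refl x m z * u).wt x = z := by simp [hf.1, hf.2, refl_wt, hm.symm]
      refine ⟨⟨?_, (hR u hf).2 h2⟩, hp, hw⟩
      rw [codimLE_iff_refl_mul (by rw [hp]; exact hm), drop, hp, hw, ← mul_assoc (refl x m z) _ u,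
        refl_mul_self hm.symm, one_mul]
      exact ⟨hc, h1⟩
    · intro u _
      rw [← mul_assoc, refl_mul_self hm.symm, one_mul]
    · intro u _
      rw [← mul_assoc, refl_mul_self hm.symm, one_mul]
    · intro u hu
      simp only [Finset.mem_filter, Finset.mem_univ, true_and] at hu
      obtain ⟨-, rfl, rfl⟩ := hu
      rw [← codim_drop (w := u) (x := x) fun hf => hm hf.1, pow_succ', drop]
  · refine Finset.sum_eq_zero fun u hu => absurd ?_ hc
    simp only [Finset.mem_filter, Finset.mem_univ, true_and] at hu
    obtain ⟨⟨h1, -⟩, rfl, rfl⟩ := hu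
    exact ((codimLE_iff_refl_mul hm).1 h1).1

open Classical in
theorem genOf_eq {R : WeightedPerm ι A → Prop} {x : ι}
    (hR : ∀ m, m ≠ x → ∀ z, ∀ u : WeightedPerm ι A, u.FixesPt x → (R (refl x m z * u) ↔ R u))
    (c : WeightedPerm ι A) :
    genOf R c = (∑ u : WeightedPerm ι A with (CodimLE u c ∧ R u) ∧ u.perm x = x, X ^ codim u) +
      X * ∑ m with m ≠ x, ∑ z with codim (refl x m z * c) + 1 = codim c,
        genOf R (drop x (refl x m z * c)) := by
  rw [genOf, ← Finset.sum_filter_add_sum_filter_not _ (fun u => u.perm x = x),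
    Finset.filter_filter, Finset.filter_filter]
  congr 1
  rw [Finset.mul_sum, ← Finset.sum_fiberwise_of_maps_to (t := Finset.univ.filter (· ≠ x))
    (g := fun u : WeightedPerm ι A => u.perm x)]
  · refine Finset.sum_congr rfl fun m hm => ?_
    have hm : m ≠ x := by simpa using hm
    conv_rhs => rw [Finset.mul_sum, Finset.sum_filter]
    rw [← Finset.sum_fiberwise_of_maps_to (t := Finset.univ)
      (g := fun u : WeightedPerm ι A => u.wt x) (by simp)]
    refine Finset.sum_congr rfl fun z _ => ?_
    rw [← sum_fiber hm z (hR m hm z)]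
    refine Finset.sum_congr ?_ fun _ _ => rfl
    ext u
    simp only [Finset.mem_filter, Finset.mem_univ, true_and]
    constructor
    · rintro ⟨⟨⟨h1, h2⟩, h3⟩, h4⟩; exact ⟨h1, h3, h4⟩
    · rintro ⟨h1, h3, h4⟩; exact ⟨⟨⟨h1, fun h => hm (h3 ▸ h)⟩, h3⟩, h4⟩
  · intro u hu
    simpa using (Finset.mem_filter.1 hu).2.2

omit [Fintype A] in
theorem balanced_refl_mul {x m : ι} (hm : m ≠ x) (z : A) {u : WeightedPerm ι A}
    (hu : u.FixesPt x) : Balanced (refl x m z * u) ↔ Balanced u := by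
  have hp : (refl x m z * u).perm x = m := by simp [hu.1]
  have hw : (refl x m z * u).wt x = z := by simp [hu.1, hu.2, refl_wt, hm.symm]
  rw [← balanced_drop_iff (x := x) (by rw [hp]; exact hm), drop, hp, hw, ← mul_assoc,
    refl_mul_self hm.symm, one_mul]

open Classical in
-- A balanced element whose permutation fixes x fixes e_x itself, so the part of the sum that does
-- not move x is the polynomial of `drop x c`.
theorem gen_eq (x : ι) (c : WeightedPerm ι A) :
    gen c = gen (drop x c) +
      X * ∑ m with m ≠ x, ∑ z with codim (refl x m z * c) + 1 = codim c,
        gen (drop x (refl x m z * c)) := by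
  rw [gen, genOf_eq (x := x) fun m hm z u hu => balanced_refl_mul hm z hu]
  congr 1
  rw [gen, genOf]
  refine Finset.sum_congr ?_ fun _ _ => rfl
  ext u
  simp only [Finset.mem_filter, Finset.mem_univ, true_and, codimLE_drop_iff]
  constructor
  · rintro ⟨⟨h1, h2⟩, h3⟩; exact ⟨⟨h1, h3, h2.wt_eq_one h3⟩, h2⟩
  · rintro ⟨⟨h1, h3⟩, h2⟩; exact ⟨⟨h1, h2⟩, h3.1⟩

theorem gen_mul_of_disjoint {L : Set ι} {c₁ c₂ : WeightedPerm ι A}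
    (h1 : ∀ j ∉ L, c₁.FixesPt j) (h2 : ∀ j ∈ L, c₂.FixesPt j)
    (H : ∀ u, CodimLE u (c₁ * c₂) → ∀ j, u.perm j ∈ L ↔ j ∈ L) :
    gen (c₁ * c₂) = gen c₁ * gen c₂ := by
  classical
  have abs_fix : ∀ {u : WeightedPerm ι A} {j}, u.FixesPt j → (abs u).FixesPt j :=
    fun h => ⟨h.1, rfl⟩
  have quot : ∀ u₁ u₂ : WeightedPerm ι A, (∀ j ∉ L, u₁.FixesPt j) → (∀ j ∈ L, u₂.FixesPt j) →
      codim ((u₁ * u₂)⁻¹ * (c₁ * c₂)) = codim (u₁⁻¹ * c₁) + codim (u₂⁻¹ * c₂) := by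
    intro u₁ u₂ g1 g2
    rw [← codim_mul_of_disjoint (L := L) (fun j hj => (g1 j hj).inv.mul (h1 j hj))
      (fun j hj => (g2 j hj).inv.mul (h2 j hj))]
    congr 1
    rw [mul_inv_rev, mul_assoc, ← mul_assoc u₁⁻¹, ← mul_assoc,
      ← commute_of_disjoint (L := L) (fun j hj => (g1 j hj).inv.mul (h1 j hj))
        (fun j hj => (g2 j hj).inv), mul_assoc]
  have hcod := codim_mul_of_disjoint h1 h2
  simp only [gen, genOf]
  rw [Finset.sum_mul_sum, ← Finset.sum_product']
  symm
  refine Finset.sum_bij (fun p _ => p.1 * p.2) ?_ ?_ ?_ ?_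
  · rintro ⟨u₁, u₂⟩ hu
    simp only [Finset.mem_product, Finset.mem_filter, Finset.mem_univ, true_and] at hu ⊢
    obtain ⟨⟨h3, h4⟩, h5, h6⟩ := hu
    have g1 := fun j hj => h3.fixesPt (h1 j hj)
    have g2 := fun j hj => h5.fixesPt (h2 j hj)
    have e1 := codim_mul_of_disjoint g1 g2
    have e2 := quot u₁ u₂ g1 g2
    have e3 := codim_mul_of_disjoint (fun j hj => abs_fix (g1 j hj))
      (fun j hj => abs_fix (g2 j hj))
    unfold CodimLE Balanced at *
    rw [map_mul]
    omega
  · rintro ⟨u₁, u₂⟩ hu ⟨v₁, v₂⟩ hv huv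
    simp only [Finset.mem_product, Finset.mem_filter, Finset.mem_univ, true_and] at hu hv huv
    have g1 := fun j hj => hu.1.1.fixesPt (h1 j hj)
    have g2 := fun j hj => hu.2.1.fixesPt (h2 j hj)
    have k1 := fun j hj => hv.1.1.fixesPt (h1 j hj)
    have k2 := fun j hj => hv.2.1.fixesPt (h2 j hj)
    have e : v₁⁻¹ * u₁ = v₂ * u₂⁻¹ := by
      rw [inv_mul_eq_iff_eq_mul, ← mul_assoc, eq_mul_inv_iff_mul_eq, huv]
    have h3 : v₁⁻¹ * u₁ = 1 := eq_one_of_fixesPt fun j => by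
      by_cases hj : j ∈ L
      · rw [e]; exact (k2 j hj).mul (g2 j hj).inv
      · exact (k1 j hj).inv.mul (g1 j hj)
    rw [h3] at e
    rw [inv_mul_eq_one] at h3
    rw [eq_comm, mul_inv_eq_one] at e
    simp [h3, e]
  · intro u hu
    simp only [Finset.mem_filter, Finset.mem_univ, true_and] at hu
    obtain ⟨h3, h4⟩ := hu
    obtain ⟨u₁, u₂, g1, g2, rfl⟩ := exists_mul_of_preserves (H u h3)
    refine ⟨(u₁, u₂), ?_, rfl⟩
    simp only [Finset.mem_product, Finset.mem_filter, Finset.mem_univ, true_and]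
    have e1 := codim_mul_of_disjoint g1 g2
    have e2 := quot u₁ u₂ g1 g2
    have e3 := codim_mul_of_disjoint (fun j hj => abs_fix (g1 j hj))
      (fun j hj => abs_fix (g2 j hj))
    -- The known equalities are sums over the two factors of these inequalities, so each inequality
    -- is an equality.
    have e4 := codim_le_add u₁ c₁
    have e5 := codim_le_add u₂ c₂
    have e6 := codim_abs_le u₁
    have e7 := codim_abs_le u₂
    unfold CodimLE Balanced at *
    rw [map_mul] at h4
    omega
  · rintro ⟨u₁, u₂⟩ hu
    simp only [Finset.mem_product, Finset.mem_filter, Finset.mem_univ, true_and] at hu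
    rw [codim_mul_of_disjoint (fun j hj => hu.1.1.fixesPt (h1 j hj))
      (fun j hj => hu.2.1.fixesPt (h2 j hj)), pow_add]

end WeightedPerm

open Polynomial in
/-- The Narayana polynomials, by their recursion. -/
noncomputable def narP : ℕ → ℚ[X]
  | 0 => 1
  | n + 1 => narP n + X * ∑ i : Fin n, narP i * narP (n - i)

open Polynomial in
/-- The rank generating polynomials of the balanced elements below a cycle of nontrivial weight. -/
noncomputable def narQ : ℕ → ℚ[X]
  | 0 => 1
  | n + 1 => narQ n + X * ∑ i : Fin n, (narP i * narQ (n - i) + narQ i * narP (n - i))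

namespace WeightedPerm

open Polynomial

variable {ι : Type*} {A : Subgroup ℂˣ} [DecidableEq ι]

/-! ### Weighted cycles -/

/-- A diagonal transformation with at most one nontrivial entry. -/
def diag (x : ι) (w : A) : WeightedPerm ι A := ⟨1, fun j => if j = x then w else 1⟩

@[simp] theorem diag_perm (x : ι) (w : A) : (diag x w).perm = 1 := rfl
theorem diag_wt (x : ι) (w : A) (j : ι) : (diag x w).wt j = if j = x then w else 1 := rfl

theorem diag_fixesPt {x j : ι} (h : j ≠ x) (w : A) : (diag x w).FixesPt j := by
  simp [FixesPt, diag_wt, h]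

@[simp] theorem diag_one (x : ι) : (diag x 1 : WeightedPerm ι A) = 1 := by
  ext1 <;> [rfl; (funext j; simp [diag_wt])]

theorem refl_mul_diag_mul_swap {x m : ι} (h : x ≠ m) (z w : A) :
    refl x m z * diag x w * ofPerm (Equiv.swap x m) = diag x z⁻¹ * diag m (z * w) := by
  ext1
  · simp
  · funext j
    simp only [mul_wt, refl_wt, diag_wt, diag_perm, ofPerm_perm, ofPerm_wt]
    by_cases h1 : j = m
    · subst h1; simp [h, h.symm]
    · by_cases h2 : j = x
      · subst h2; simp [h, h.symm]
      · simp [h1, h2, Equiv.swap_apply_of_ne_of_ne h2 h1]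

/-- The cycle through a list, with weight `w`. -/
def cyc : List ι → A → WeightedPerm ι A
  | [], _ => 1
  | x :: l, w => diag x w * ofPerm (x :: l).formPerm

theorem cyc_cons (x : ι) (l : List ι) (w : A) :
    cyc (x :: l) w = diag x w * ofPerm (x :: l).formPerm := rfl

theorem cyc_fixesPt {l : List ι} {j : ι} (h : j ∉ l) (w : A) : (cyc l w).FixesPt j := by
  cases l with
  | nil => exact fixesPt_one j
  | cons x l =>
    refine FixesPt.mul (diag_fixesPt (fun hj => h (by simp [hj])) w) ⟨?_, rfl⟩
    exact List.formPerm_apply_of_notMem h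

/-- Splitting off a transposition cuts the cycle into two, the second one starting at m. -/
theorem formPerm_append_cons {x m : ι} {l₁ l₂ : List ι} (h : (x :: (l₁ ++ m :: l₂)).Nodup) :
    (x :: (l₁ ++ m :: l₂)).formPerm =
      Equiv.swap x m * (x :: l₁).formPerm * (m :: l₂).formPerm := by
  induction l₁ generalizing x with
  | nil => simp
  | cons y l₁ ih =>
    have h' : (y :: (l₁ ++ m :: l₂)).Nodup := h.of_cons
    have hxy : x ≠ y := fun e => by simp [e] at h
    have hxm : x ≠ m := fun e => by simp [e] at h
    have hym : y ≠ m := fun e => by simp [e] at h'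
    have e : Equiv.swap x y * Equiv.swap y m = Equiv.swap x m * Equiv.swap x y := by
      ext j
      simp only [Equiv.Perm.coe_mul, Function.comp_apply, Equiv.swap_apply_def]
      split_ifs <;> simp_all
    rw [List.cons_append, List.formPerm_cons_cons, ih h', List.formPerm_cons_cons]
    simp only [← mul_assoc]
    rw [e]

/-- The weighted version of the cut: the pieces have weights z⁻¹ and zw, with product w. -/
theorem refl_mul_cyc {x m : ι} {l₁ l₂ : List ι} (h : (x :: (l₁ ++ m :: l₂)).Nodup) (z w : A) :
    refl x m z * cyc (x :: (l₁ ++ m :: l₂)) w = cyc (x :: l₁) z⁻¹ * cyc (m :: l₂) (z * w) := by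
  have hxm : x ≠ m := fun e => by simp [e] at h
  have hm : m ∉ x :: l₁ := by
    intro hm
    rw [← List.cons_append, List.nodup_append] at h
    exact h.2.2 m hm m (by simp) rfl
  rw [cyc_cons, formPerm_append_cons h, map_mul, map_mul, cyc_cons, cyc_cons]
  simp only [← mul_assoc]
  rw [refl_mul_diag_mul_swap hxm]
  congr 1
  rw [mul_assoc, mul_assoc]
  congr 1
  refine (commute_of_disjoint (L := {j | j ∈ x :: l₁})
    (fun j hj => ⟨List.formPerm_apply_of_notMem hj, rfl⟩) (fun j hj => ?_)).symm
  refine diag_fixesPt (fun e => hm ?_) _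
  rw [← e]; exact hj

theorem drop_mul_of_fixesPt {x : ι} {c₁ c₂ : WeightedPerm ι A} (h : c₂.FixesPt x) :
    drop x (c₁ * c₂) = drop x c₁ * c₂ := by
  simp [drop, h.1, h.2, mul_assoc]

theorem refl_one_mul_cyc {x y : ι} {l : List ι} (h : x ≠ y) (w : A) :
    refl x y 1 * cyc (x :: y :: l) w = cyc (y :: l) w := by
  rw [cyc_cons, List.formPerm_cons_cons, map_mul, ← mul_assoc, ← mul_assoc,
    refl_mul_diag_mul_swap h]
  simp [cyc_cons]

theorem drop_cyc {x : ι} {l : List ι} (h : (x :: l).Nodup) (w : A) :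
    drop x (cyc (x :: l) w) = cyc l w := by
  cases l with
  | nil =>
    ext1
    · simp [drop, cyc, Equiv.Perm.one_def]
    · funext j
      by_cases hj : j = x <;> simp [drop, cyc, refl_wt, diag_wt, hj]
  | cons y l =>
    have hxy : x ≠ y := fun e => by simp [e] at h
    have h1 : (cyc (x :: y :: l) w).perm x = y := by
      simp only [cyc_cons, mul_perm, diag_perm, one_mul, ofPerm_perm]
      exact List.formPerm_apply_head x y l h
    have h2 : (cyc (x :: y :: l) w).wt x = 1 := by
      simp only [cyc_cons, mul_wt, ofPerm_perm, ofPerm_wt, List.formPerm_apply_head x y l h]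
      simp [diag_wt, hxy.symm]
    rw [drop, h1, h2, refl_one_mul_cyc hxy]

variable [Fintype ι]

open Classical in
theorem codim_cyc {x : ι} {l : List ι} (h : (x :: l).Nodup) (w : A) :
    codim (cyc (x :: l) w) = l.length + if w = 1 then 0 else 1 := by
  induction l generalizing x with
  | nil =>
    split_ifs with hw
    · simp [cyc, hw]
    · have : ¬ (cyc [x] w).FixesPt x := fun hf => hw (by simpa [cyc, diag_wt] using hf.2)
      rw [← codim_drop this, drop_cyc h]
      simp [cyc]
  | cons y l ih =>
    have : ¬ (cyc (x :: y :: l) w).FixesPt x := by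
      intro hf
      have h1 := hf.1
      simp only [cyc_cons, mul_perm, diag_perm, one_mul, ofPerm_perm] at h1
      rw [List.formPerm_apply_head x y l h] at h1
      simp [h1] at h
    rw [← codim_drop this, drop_cyc h, ih h.of_cons, List.length_cons]
    omega

theorem codimLE_refl {x m : ι} (hm : m ≠ x) {z : A} {c : WeightedPerm ι A}
    (h : codim (refl x m z * c) + 1 = codim c) : CodimLE (refl x m z) c := by
  have h1 : (refl x m z)⁻¹ = refl x m z := inv_eq_of_mul_eq_one_left (refl_mul_self hm.symm z)
  have h2 := codim_le_add (refl x m z) c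
  have h3 := codim_refl_le x m z
  unfold CodimLE
  rw [h1] at *
  omega

omit [Fintype ι] in
theorem mem_cyc_perm {l : List ι} (w : A) (j : ι) : (cyc l w).perm j ∈ l ↔ j ∈ l := by
  cases l with
  | nil => simp
  | cons x l =>
    simp only [cyc_cons, mul_perm, diag_perm, one_mul, ofPerm_perm]
    exact ⟨fun h => List.mem_of_formPerm_apply_mem h, fun h => List.formPerm_apply_mem_of_mem h⟩

/-- The elements below a product with a cycle of weight `1` preserve the cycle. -/
theorem preserves_of_codimLE {l : List ι} {c u : WeightedPerm ι A} (hc : ∀ j ∈ l, c.FixesPt j)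
    (h : CodimLE u (cyc l 1 * c)) (j : ι) : u.perm j ∈ l ↔ j ∈ l := by
  -- The indicator vector of the cycle is fixed by the product, hence by u, and so u preserves its
  -- support.
  have h1 : (fun j => if j ∈ l then (1 : ℂ) else 0) ∈ fixSub (cyc l (1 : A) * c) := by
    rw [commute_of_disjoint (L := {j | j ∈ l}) (fun j hj => cyc_fixesPt hj 1) hc]
    refine inf_fixSub_le _ _ ⟨?_, ?_⟩
    · intro j
      by_cases hj : j ∈ l
      · simp [hj, (hc j hj).1, (hc j hj).2]
      · have : c.perm j ∉ l := fun hm => hj (c.perm.injective (hc _ hm).1 ▸ hm)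
        simp [hj, this]
    · intro j
      have hw : (cyc l (1 : A)).wt j = 1 := by
        cases l <;> simp [cyc]
      simp only [mem_cyc_perm, hw]
      simp
  have h2 := h.fixSub_le h1 j
  have hz : ((u.wt j : ℂˣ) : ℂ) ≠ 0 := Units.ne_zero _
  by_cases hj : j ∈ l <;> by_cases hu : u.perm j ∈ l <;> simp_all

variable [Fintype A]

/-- One of the weights has to be trivial: the elements below then preserve that cycle, hence also
its complement, and split. Below two cycles of nontrivial weight there may be elements that join
them. -/
theorem gen_cyc_mul_cyc {l₁ l₂ : List ι} (h : ∀ j ∈ l₁, j ∉ l₂) {w₁ w₂ : A}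
    (hw : w₁ = 1 ∨ w₂ = 1) :
    gen (cyc l₁ w₁ * cyc l₂ w₂) = gen (cyc l₁ w₁) * gen (cyc l₂ w₂) := by
  rcases hw with rfl | rfl
  · exact gen_mul_of_disjoint (L := {j | j ∈ l₁}) (fun j hj => cyc_fixesPt hj _)
      (fun j hj => cyc_fixesPt (h j hj) _)
      fun u hu j => preserves_of_codimLE (fun j hj => cyc_fixesPt (h j hj) _) hu j
  · have h' : ∀ j ∈ l₂, j ∉ l₁ := fun j hj hj' => h j hj' hj
    refine gen_mul_of_disjoint (L := {j | j ∉ l₂})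
      (fun j hj => cyc_fixesPt (h' j (not_not.1 hj)) _) (fun j hj => cyc_fixesPt hj _)
      fun u hu j => not_congr ?_
    rw [commute_of_disjoint (L := {j | j ∈ l₁}) (fun j hj => cyc_fixesPt hj _)
      (fun j hj => cyc_fixesPt (h j hj) _)] at hu
    exact preserves_of_codimLE (fun j hj => cyc_fixesPt (h' j hj) _) hu j

open Classical in
-- Induction on the length by `gen_eq` at the head. The reflection cuts the cycle at m, and dropping
-- the head from the first piece leaves cycles of lengths i and `l.length - i`, one of them of
-- weight 1.
theorem gen_cyc (l : List ι) (hl : l.Nodup) (w : A) :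
    gen (cyc l w) = if w = 1 then narP l.length else narQ l.length := by
  induction hn : l.length using Nat.strong_induction_on generalizing l w with
  | _ n ih =>
    cases l with
    | nil =>
      subst hn
      simp [cyc, gen_one, narP, narQ]
    | cons x l =>
      have hx : x ∉ l := (List.nodup_cons.1 hl).1
      have hl' : l.Nodup := (List.nodup_cons.1 hl).2
      rw [List.length_cons] at hn
      set g : ι → ℚ[X] := fun m => ∑ z with
        codim (refl x m z * cyc (x :: l) w) + 1 = codim (cyc (x :: l) w),
        gen (drop x (refl x m z * cyc (x :: l) w)) with hg
      -- A reflection below the cycle fixes every basis vector off the cycle, so only targets on it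
      -- contribute.
      have hsum : ∑ m with m ≠ x, g m = ∑ i : Fin l.length, g l[i] := by
        have h1 : ∑ i : Fin l.length, g l[i] = ∑ m ∈ l.toFinset, g m := by
          rw [List.sum_toFinset _ hl', ← Fin.sum_univ_fun_getElem]
          rfl
        rw [h1]
        symm
        refine Finset.sum_subset (fun m hm => ?_) (fun m hm hml => ?_)
        · rw [List.mem_toFinset] at hm
          simpa using fun e : m = x => hx (e ▸ hm)
        · have hm : m ≠ x := by simpa using hm
          rw [List.mem_toFinset] at hml
          refine Finset.sum_eq_zero fun z hz => ?_
          exfalso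
          have h2 := codimLE_refl hm (Finset.mem_filter.1 hz).2
          have h3 := (h2.fixesPt (cyc_fixesPt (l := x :: l) (j := m) (by simp [hm, hml]) w)).1
          simp at h3
          exact hm h3.symm
      have hterm : ∀ i : Fin l.length, g l[i] = if w = 1 then
          narP i * narP (l.length - i) else
          narP i * narQ (l.length - i) + narQ i * narP (l.length - i) := by
        intro i
        have hi := i.2
        have e : l = l.take i ++ l[i] :: l.drop (i + 1) := by
          rw [Fin.getElem_fin, ← List.drop_eq_getElem_cons, List.take_append_drop]
        have len1 : (l.take i).length = i := by simp
        have len2 : (l[i] :: l.drop (i + 1)).length = l.length - i := by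
          simp
        set m := l[i] with hm
        set l₁ := l.take i
        set l₂ := l.drop (i + 1)
        have hnd : (x :: (l₁ ++ m :: l₂)).Nodup := by rw [← e]; exact hl
        have hxm : x ∉ m :: l₂ := fun h => hx (by rw [e]; exact List.mem_append_right _ h)
        have hnd' := hnd
        rw [← List.cons_append, List.nodup_append] at hnd'
        obtain ⟨n1, n2, n3⟩ := hnd'
        have hdis : ∀ j ∈ x :: l₁, j ∉ m :: l₂ := fun j hj hj' => n3 j hj j hj' rfl
        -- The codimension falls exactly when the cut creates no additional piece of nontrivial
        -- weight: both pieces have weight 1 if w = 1, and exactly one of them has if w ≠ 1.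
        have hcod : ∀ z : A, (codim (refl x m z * cyc (x :: l) w) + 1 = codim (cyc (x :: l) w)) ↔
            if w = 1 then z = 1 else z = 1 ∨ z = w⁻¹ := by
          intro z
          rw [codim_cyc hl, e, refl_mul_cyc hnd,
            codim_mul_of_disjoint (L := {j | j ∈ x :: l₁}) (fun j hj => cyc_fixesPt hj _)
              (fun j hj => cyc_fixesPt (hdis j hj) _), codim_cyc n1, codim_cyc n2,
            List.length_append, List.length_cons]
          by_cases hw : w = 1
          · by_cases hz : z = 1 <;> simp [hw, hz] <;> omega
          · by_cases hz : z = 1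
            · simp [hw, hz]
            · by_cases hz' : z * w = 1
              · have := eq_inv_of_mul_eq_one_left hz'
                simp [hw, this]
                omega
              · have hz'' : z ≠ w⁻¹ := fun h => hz' (by simp [h])
                simp [hw, hz, hz', hz'']
        have hgen : ∀ z : A, (z = 1 ∨ z = w⁻¹) → gen (drop x (refl x m z * cyc (x :: l) w)) =
            (if z = 1 then narP i else narQ i) *
              if z * w = 1 then narP (l.length - i) else narQ (l.length - i) := by
          intro z hz
          have e' : refl x m z * cyc (x :: l) w = cyc (x :: l₁) z⁻¹ * cyc (m :: l₂) (z * w) := by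
            rw [← refl_mul_cyc hnd, ← e]
          rw [e', drop_mul_of_fixesPt (cyc_fixesPt hxm _), drop_cyc n1,
            gen_cyc_mul_cyc (fun j hj => hdis j (List.mem_cons_of_mem _ hj)),
            ih i (by omega) l₁ n1.of_cons _ len1,
            ih (l.length - i) (by omega) (m :: l₂) n2 _ len2]
          · simp
          · rcases hz with rfl | rfl <;> simp
        rw [hg]
        simp only
        by_cases hw : w = 1
        · rw [Finset.filter_congr fun z _ => hcod z]
          subst hw
          simp only [if_true, Finset.filter_eq', Finset.mem_univ, Finset.sum_singleton]
          rw [hgen 1 (Or.inl rfl)]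
          simp
        · rw [Finset.filter_congr fun z _ => hcod z]
          have hw' : (1 : A) ≠ w⁻¹ := fun h => hw (by simpa using h.symm)
          have : (Finset.univ.filter fun z : A => if w = 1 then z = 1 else z = 1 ∨ z = w⁻¹) =
              {1, w⁻¹} := by
            ext z; simp [hw]
          rw [this, Finset.sum_pair hw', hgen 1 (Or.inl rfl), hgen w⁻¹ (Or.inr rfl)]
          simp [hw]
      rw [gen_eq x, drop_cyc hl, hsum, ih l.length (by omega) l hl' w rfl]
      subst hn
      simp_rw [hterm]
      split_ifs
      · rw [narP]
      · rw [narQ]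

/-! ### Normal form of a cycle under diagonal conjugation. -/

omit [Fintype A] in
theorem weight_refl {x m : ι} (h : m ≠ x) (z : A) : weight (refl x m z) = 1 := by
  rw [weight_apply, ← Finset.mul_prod_erase _ _ (Finset.mem_univ m),
    ← Finset.mul_prod_erase _ _ (Finset.mem_erase.2 ⟨h.symm, Finset.mem_univ x⟩),
    Finset.prod_eq_one]
  · simp [refl_wt, h.symm]
  · intro j hj
    simp only [Finset.mem_erase] at hj
    simp [refl_wt, hj.1, hj.2.1]

omit [Fintype A] in
theorem weight_diag (x : ι) (w : A) : weight (diag x w) = w := by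
  simp [weight_apply, diag_wt]

omit [Fintype A] in
-- A diagonal conjugation collects all weights at the head of the cycle, so only their product
-- matters.
theorem exists_conj_cyc {l : List ι} (hl : l.Nodup) (h0 : l ≠ []) {u : WeightedPerm ι A}
    (hp : u.perm = l.formPerm) (hw : ∀ j ∉ l, u.wt j = 1) :
    ∃ g : WeightedPerm ι A, g.perm = 1 ∧ g * u * g⁻¹ = cyc l (weight u) := by
  induction l generalizing u with
  | nil => exact absurd rfl h0
  | cons x l ih =>
    cases l with
    | nil =>
      refine ⟨1, rfl, ?_⟩
      have hu : u = diag x (u.wt x) := by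
        ext1
        · simp [hp]
        · funext j
          by_cases hj : j = x
          · simp [hj, diag_wt]
          · rw [hw j (by simpa using hj)]; simp [diag_wt, hj]
      have hW : weight u = u.wt x := by rw [hu, weight_diag]; simp [diag_wt]
      simp [cyc, hW, ← hu]
    | cons y l =>
      have hxy : x ≠ y := fun e => by simp [e] at hl
      have hxyl : x ∉ y :: l := (List.nodup_cons.1 hl).1
      have hux : u.perm x = y := by rw [hp]; exact List.formPerm_apply_head x y l hl
      obtain ⟨g, hg, hgu⟩ := ih (u := drop x u) hl.of_cons (by simp)
        (by rw [drop, mul_perm, hux, hp, refl_perm, List.formPerm_cons_cons]; simp) (by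
          intro j hj
          by_cases hjx : j = x
          · rw [hjx]; exact (drop_fixesPt x u).2
          · have hj' : j ∉ x :: y :: l := by simpa [hjx] using hj
            have hjy : j ≠ y := fun e => by simp [e] at hj
            rw [drop, mul_wt, hw j hj', hux, hp, List.formPerm_apply_of_notMem hj']
            simp [refl_wt, hjx, hjy])
      have hW : weight (drop x u) = weight u := by
        rw [drop, map_mul, hux, weight_refl hxy.symm, one_mul]
      rw [hW] at hgu
      -- With this entry at x the conjugation turns the first reflection of u into an unweighted
      -- transposition.
      set b : A := g.wt y * u.wt x * (g.wt x)⁻¹ with hb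
      refine ⟨diag x b * g, by simp [hg], ?_⟩
      have hu : u = refl x y (u.wt x) * drop x u := by
        rw [drop, hux, ← mul_assoc, refl_mul_self hxy, one_mul]
      have hconj : diag x b * g * refl x y (u.wt x) * (diag x b * g)⁻¹ = refl x y 1 := by
        rw [mul_inv_eq_iff_eq_mul]
        ext1
        · simp [hg]
        · funext j
          simp only [mul_wt, mul_perm, hg, diag_perm, refl_perm, diag_wt, refl_wt]
          by_cases h1 : j = y
          · subst h1; simp [hxy.symm, hb, mul_comm, mul_left_comm]
          · by_cases h2 : j = x
            · subst h2; simp [h1, hxy.symm, hb]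
            · simp [h1, h2, Equiv.swap_apply_of_ne_of_ne h2 h1]
      have hcomm : diag x b * cyc (y :: l) (weight u) * (diag x b)⁻¹ =
          cyc (y :: l) (weight u) := by
        rw [mul_inv_eq_iff_eq_mul]
        refine (commute_of_disjoint (L := {j | j ∈ y :: l}) (fun j hj => cyc_fixesPt hj _)
          fun j hj => diag_fixesPt (fun e => hxyl (by rw [← e]; exact hj)) _).symm
      calc diag x b * g * u * (diag x b * g)⁻¹
          = diag x b * g * (refl x y (u.wt x) * drop x u) * (diag x b * g)⁻¹ := by rw [← hu]
        _ = (diag x b * g * refl x y (u.wt x) * (diag x b * g)⁻¹) *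
            (diag x b * (g * drop x u * g⁻¹) * (diag x b)⁻¹) := by group
        _ = cyc (x :: y :: l) (weight u) := by
          rw [hconj, hgu, hcomm, ← refl_one_mul_cyc hxy, ← mul_assoc, refl_mul_self hxy, one_mul]

open Classical in
theorem gen_of_perm_eq_formPerm {l : List ι} (hl : l.Nodup) (h0 : l ≠ []) {u : WeightedPerm ι A}
    (hp : u.perm = l.formPerm) (hw : ∀ j ∉ l, u.wt j = 1) :
    gen u = if weight u = 1 then narP l.length else narQ l.length := by
  obtain ⟨g, -, hg⟩ := exists_conj_cyc hl h0 hp hw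
  rw [← gen_conj g, hg, gen_cyc l hl]

open Classical in
omit [Fintype A] in
theorem codim_of_perm_eq_formPerm {l : List ι} (hl : l.Nodup) (h0 : l ≠ [])
    {u : WeightedPerm ι A} (hp : u.perm = l.formPerm) (hw : ∀ j ∉ l, u.wt j = 1) :
    codim u + 1 = l.length + if weight u = 1 then 0 else 1 := by
  obtain ⟨g, -, hg⟩ := exists_conj_cyc hl h0 hp hw
  cases l with
  | nil => exact absurd rfl h0
  | cons x l =>
    rw [← codim_conj g, hg, codim_cyc hl, List.length_cons]
    omega

end WeightedPerm

namespace WeightedPerm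

open Polynomial

variable {ι : Type*} {A : Subgroup ℂˣ} [DecidableEq ι] [Fintype ι]

/-! ### Factorizations into reflections -/

omit [Fintype ι] in
theorem drop_of_perm_eq_one {D : WeightedPerm ι A} (hD : D.perm = 1) (x : ι) :
    drop x D = diag x (D.wt x)⁻¹ * D := by
  ext1
  · simp [drop, hD, Equiv.Perm.one_def]
  · funext j
    by_cases hj : j = x <;> simp [drop, hD, refl_wt, diag_wt, hj]

/-- Entries with product 1 cannot have exactly one nontrivial member; clearing two of them lowers
the codimension by 2. -/
theorem exists_two_of_weight_eq_one {D : WeightedPerm ι A} (hD : D.perm = 1)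
    (hW : weight D = 1) (h1 : D ≠ 1) :
    ∃ j k, j ≠ k ∧ codim (diag k (D.wt k)⁻¹ * (diag j (D.wt j)⁻¹ * D)) + 2 = codim D := by
  obtain ⟨j, hj⟩ : ∃ j, D.wt j ≠ 1 := by
    by_contra! h
    exact h1 (eq_one_of_fixesPt fun j => ⟨by rw [hD]; rfl, h j⟩)
  obtain ⟨k, hk, hk'⟩ : ∃ k ∈ Finset.univ.erase j, D.wt k ≠ 1 := by
    by_contra! h
    rw [weight_apply, ← Finset.mul_prod_erase _ _ (Finset.mem_univ j), Finset.prod_eq_one h,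
      mul_one] at hW
    exact hj hW
  have hjk : k ≠ j := (Finset.mem_erase.1 hk).1
  refine ⟨j, k, hjk.symm, ?_⟩
  have e1 := codim_drop (w := D) (x := j) fun hf => hj hf.2
  have hp : (drop j D).perm = 1 := by rw [drop_of_perm_eq_one hD]; simp [hD]
  have hw : (drop j D).wt k = D.wt k := by
    rw [drop_of_perm_eq_one hD]; simp [hD, diag_wt, hjk]
  have e2 := codim_drop (w := drop j D) (x := k) fun hf => hk' (by rw [← hw]; exact hf.2)
  rw [drop_of_perm_eq_one hp, hw, drop_of_perm_eq_one hD] at e2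
  rw [drop_of_perm_eq_one hD] at e1
  omega

/-- A reflection of weight `1`. -/
def IsWtReflection (t : WeightedPerm ι A) : Prop := codim t = 1 ∧ weight t = 1

theorem isWtReflection_refl {x m : ι} (h : m ≠ x) (z : A) : IsWtReflection (refl x m z) := by
  refine ⟨le_antisymm (codim_refl_le x m z) ?_, weight_refl h z⟩
  by_contra h0
  have := codim_eq_zero (u := refl x m z) (by omega)
  have := congrArg (fun w : WeightedPerm ι A => w.perm x) this
  simp at this
  exact h this

/-- Moved basis vectors are dropped one at a time by reflections of weight 1. The remaining diagonal
factor has the excess of u as its codimension. -/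
theorem exists_prod_refl_mul_diagonal (u : WeightedPerm ι A) :
    ∃ (L : List (WeightedPerm ι A)) (D : WeightedPerm ι A), L.prod * D = u ∧
      L.length = codim (abs u) ∧ (∀ t ∈ L, IsWtReflection t) ∧ D.perm = 1 ∧
      codim D + codim (abs u) = codim u := by
  induction hk : codim u using Nat.strong_induction_on generalizing u with
  | _ k ih =>
    by_cases h : ∀ j, u.perm j = j
    · refine ⟨[], u, by simp, by simp [abs_eq_one h], by simp, Equiv.ext h, ?_⟩
      simp [abs_eq_one h, hk]
    · push Not at h
      obtain ⟨x, hx⟩ := h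
      have h1 := codim_drop (w := u) (x := x) fun hf => hx hf.1
      have h2 := codim_abs_drop hx
      obtain ⟨L, D, e1, e2, e3, e4, e5⟩ := ih _ (by omega) (drop x u) rfl
      refine ⟨refl x (u.perm x) (u.wt x) :: L, D, ?_, ?_, ?_, e4, by omega⟩
      · rw [List.prod_cons, mul_assoc, e1, drop, ← mul_assoc, refl_mul_self hx.symm, one_mul]
      · rw [List.length_cons, e2, h2]
      · rintro t (_ | ⟨_, ht⟩)
        · exact isWtReflection_refl hx _
        · exact e3 t ht

omit [DecidableEq ι] in
theorem weight_prod_eq_one {L : List (WeightedPerm ι A)} (h : ∀ t ∈ L, IsWtReflection t) :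
    weight L.prod = 1 := by
  rw [map_list_prod]
  refine List.prod_eq_one ?_
  simpa using fun t ht => (h t ht).2

theorem Balanced.weight_eq_one {u : WeightedPerm ι A} (hu : Balanced u) : weight u = 1 := by
  obtain ⟨L, D, e1, e2, e3, e4, e5⟩ := exists_prod_refl_mul_diagonal u
  have hD : D = 1 := codim_eq_zero (by unfold Balanced at hu; omega)
  rw [← e1, hD, mul_one, weight_prod_eq_one e3]

/-- An excess of exactly 1 would leave a diagonal of weight 1 with a single nontrivial entry. -/
theorem balanced_of_weight_eq_one {u : WeightedPerm ι A} (h : codim u ≤ codim (abs u) + 1)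
    (hu : weight u = 1) : Balanced u := by
  obtain ⟨L, D, e1, e2, e3, e4, e5⟩ := exists_prod_refl_mul_diagonal u
  have hW : weight D = 1 := by
    rw [← e1, map_mul, weight_prod_eq_one e3, one_mul] at hu
    exact hu
  by_cases hD : D = 1
  · rw [hD, codim_one] at e5
    unfold Balanced
    omega
  · obtain ⟨j, k, -, hc⟩ := exists_two_of_weight_eq_one e4 hW hD
    omega

theorem exists_factorization {u : WeightedPerm ι A} (h : codim u ≤ codim (abs u) + 2)
    (hu : weight u = 1) : ∃ L : List (WeightedPerm ι A), L.prod = u ∧ L.length = codim u ∧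
      ∀ t ∈ L, IsWtReflection t := by
  obtain ⟨L, D, e1, e2, e3, e4, e5⟩ := exists_prod_refl_mul_diagonal u
  have hW : weight D = 1 := by
    rw [← e1, map_mul, weight_prod_eq_one e3, one_mul] at hu
    exact hu
  by_cases hD : D = 1
  · refine ⟨L, by rw [← e1, hD, mul_one], ?_, e3⟩
    rw [hD, codim_one] at e5
    omega
  · obtain ⟨j, k, hjk, hc⟩ := exists_two_of_weight_eq_one e4 hW hD
    have h1 := codim_eq_zero (u := diag k (D.wt k)⁻¹ * (diag j (D.wt j)⁻¹ * D)) (by omega)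
    have hw : ∀ i, (diag k (D.wt k)⁻¹).wt i * ((diag j (D.wt j)⁻¹).wt i * D.wt i) = 1 := by
      intro i
      have := congrArg (fun w : WeightedPerm ι A => w.wt i) h1
      simpa [e4] using this
    have hjk' : D.wt j * D.wt k = 1 := by
      have h2 : weight (diag k (D.wt k)⁻¹ * (diag j (D.wt j)⁻¹ * D)) = 1 := by rw [h1, map_one]
      rw [map_mul, map_mul, weight_diag, weight_diag, hW, mul_one, ← mul_inv_rev, inv_eq_one] at h2
      exact h2
    -- The diagonal has inverse entries at j and k and is trivial elsewhere; such an element is the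
    -- product of two reflections exchanging the lines of e_j and e_k.
    refine ⟨L ++ [refl j k 1, refl j k (D.wt j)], ?_, ?_, ?_⟩
    · rw [List.prod_append, ← e1]
      congr 1
      ext1
      · simp [e4]
      · funext i
        have := hw i
        by_cases hi : i = j
        · subst hi; simp [refl_wt, hjk]
        · by_cases hi' : i = k
          · subst hi'
            simp [refl_wt, hjk, eq_inv_of_mul_eq_one_right hjk']
          · simp only [diag_wt, hi, hi', if_false, one_mul] at this
            simp [refl_wt, hi, hi', this]
    · rw [List.length_append, e2, List.length_cons, List.length_singleton]
      omega
    · intro t ht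
      rw [List.mem_append] at ht
      rcases ht with ht | ht
      · exact e3 t ht
      · simp only [List.mem_cons, List.not_mem_nil, or_false] at ht
        rcases ht with rfl | rfl <;> exact isWtReflection_refl hjk.symm _

omit [DecidableEq ι] in
theorem le_length_of_prod_eq {L : List (WeightedPerm ι A)} (h : ∀ t ∈ L, IsWtReflection t) :
    codim L.prod ≤ L.length := by
  induction L with
  | nil => simp
  | cons t L ih =>
    rw [List.prod_cons, List.length_cons]
    have h1 := codim_mul_le t L.prod
    have h2 := (h t (by simp)).1
    have h3 := ih fun s hs => h s (by simp [hs])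
    omega

/-! ### The elements below a cycle and a fixed point, both of nontrivial weight -/

variable [Fintype A]

theorem genOf_weight_eq_gen {c : WeightedPerm ι A} (hc : codim c ≤ codim (abs c) + 1) :
    genOf (fun u => weight u = 1) c = gen c := by
  classical
  refine Finset.sum_congr (Finset.ext fun u => ?_) fun _ _ => rfl
  simp only [Finset.mem_filter, Finset.mem_univ, true_and]
  refine and_congr_right fun h => ⟨fun hW => balanced_of_weight_eq_one ?_ hW,
    Balanced.weight_eq_one⟩
  have := h.excess_add_le
  omega

/-- `c` is a cycle through `l` together with a fixed point `b`, of inverse weights different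
from `1`. -/
structure IsCoxeterLike (b : ι) (l : List ι) (c : WeightedPerm ι A) : Prop where
  nodup : l.Nodup
  ne_nil : l ≠ []
  mem_iff : ∀ j, j ∈ l ↔ j ≠ b
  perm_eq : c.perm = l.formPerm
  wt_ne : c.wt b ≠ 1
  weight_eq : weight c = 1

namespace IsCoxeterLike

variable {b : ι} {l : List ι} {c : WeightedPerm ι A}

omit [Fintype A] in
theorem perm_fix (h : IsCoxeterLike b l c) : c.perm b = b := by
  rw [h.perm_eq]
  exact List.formPerm_apply_of_notMem fun hb => (h.mem_iff b).1 hb rfl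

omit [Fintype A] in
theorem drop_perm (h : IsCoxeterLike b l c) : (drop b c).perm = l.formPerm := by
  rw [drop, h.perm_fix, mul_perm, refl_perm, Equiv.swap_self, h.perm_eq]
  rfl

omit [Fintype A] in
theorem eq_of_notMem (h : IsCoxeterLike b l c) {j : ι} (hj : j ∉ l) : j = b := by
  by_contra hne
  exact hj ((h.mem_iff j).2 hne)

omit [Fintype A] in
theorem drop_wt (h : IsCoxeterLike b l c) {j : ι} (hj : j ∉ l) : (drop b c).wt j = 1 := by
  rw [h.eq_of_notMem hj]
  exact (drop_fixesPt b c).2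

omit [Fintype A] in
theorem weight_drop (h : IsCoxeterLike b l c) : weight (drop b c) ≠ 1 := by
  have : (refl b b (c.wt b) : WeightedPerm ι A) = diag b (c.wt b)⁻¹ := by
    ext1
    · simp [Equiv.Perm.one_def]
    · funext j; by_cases hj : j = b <;> simp [refl_wt, diag_wt, hj]
  rw [drop, h.perm_fix, this, map_mul, weight_diag, h.weight_eq, mul_one, Ne, inv_eq_one]
  exact h.wt_ne

omit [Fintype A] in
theorem codim_drop (h : IsCoxeterLike b l c) : codim (drop b c) = l.length := by
  have := codim_of_perm_eq_formPerm h.nodup h.ne_nil h.drop_perm fun j => h.drop_wt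
  simpa [h.weight_drop] using this

omit [Fintype A] in
theorem codim_eq (h : IsCoxeterLike b l c) : codim c = l.length + 1 := by
  rw [← h.codim_drop, WeightedPerm.codim_drop fun hf => h.wt_ne hf.2]

omit [Fintype A] in
theorem codim_abs_add_one (h : IsCoxeterLike b l c) : codim (abs c) + 1 = l.length := by
  have h1 : weight (abs c) = 1 := by simp [weight_apply]
  have := codim_of_perm_eq_formPerm (u := abs c) h.nodup h.ne_nil h.perm_eq fun _ _ => rfl
  simpa [h1] using this

open Classical in
theorem sum_fixesPt (h : IsCoxeterLike b l c) :
    ∑ u : WeightedPerm ι A with (CodimLE u c ∧ weight u = 1) ∧ u.FixesPt b, X ^ codim u =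
      narQ l.length := by
  have h1 := gen_of_perm_eq_formPerm h.nodup h.ne_nil h.drop_perm fun j => h.drop_wt
  rw [if_neg h.weight_drop, ← genOf_weight_eq_gen, genOf] at h1
  · rw [← h1]
    refine Finset.sum_congr (Finset.ext fun u => ?_) fun _ _ => rfl
    simp only [Finset.mem_filter, Finset.mem_univ, true_and, codimLE_drop_iff]
    tauto
  · have h2 : abs (drop b c) = abs c := by
      ext1
      · exact h.drop_perm.trans h.perm_eq.symm
      · rfl
    rw [h2, h.codim_abs_add_one, h.codim_drop]

open Classical in
-- The Kreweras complement u ↦ u⁻¹c is a bijection onto the elements that fix e_b, and it subtracts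
-- the codimension from that of c.
theorem sum_not_fixesPt (h : IsCoxeterLike b l c) :
    ∑ u : WeightedPerm ι A with (CodimLE u c ∧ weight u = 1) ∧ u.perm b = b ∧ u.wt b ≠ 1,
      X ^ codim u = (narQ l.length).reflect (l.length + 1) := by
  let φ : ℚ[X] →+ ℚ[X] :=
    { toFun := reflect (l.length + 1), map_zero' := reflect_zero, map_add' := fun f g =>
        reflect_add f g _ }
  change _ = φ (narQ l.length)
  rw [← h.sum_fixesPt, map_sum]
  refine Finset.sum_bij' (fun u _ => u⁻¹ * c) (fun v _ => c * v⁻¹) ?_ ?_ ?_ ?_ ?_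
  · intro u hu
    simp only [Finset.mem_filter, Finset.mem_univ, true_and] at hu ⊢
    obtain ⟨⟨h1, h2⟩, h3, h4⟩ := hu
    have hp : (u⁻¹ * c).perm b = b := by
      rw [mul_perm, inv_perm, Equiv.Perm.mul_apply, h.perm_fix, Equiv.Perm.inv_eq_iff_eq, h3]
    refine ⟨⟨h1.kreweras, by rw [map_mul, map_inv, h2, h.weight_eq]; simp⟩, hp, ?_⟩
    by_contra hw
    -- If both u and u⁻¹c scaled e_b nontrivially, both fixed spaces would lie in the hyperplane y b
    -- = 0, contrary to `CodimLE.sup_eq_top`.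
    have zero_of : ∀ v : WeightedPerm ι A, v.perm b = b → v.wt b ≠ 1 →
        ∀ y ∈ fixSub v, y b = 0 := by
      intro v hv hv' y hy
      have := hy b
      rw [hv] at this
      by_contra h0
      refine hv' ?_
      ext
      have h5 : (((v.wt b : ℂˣ) : ℂ) - 1) * y b = 0 := by linear_combination -this
      rcases mul_eq_zero.1 h5 with h6 | h6
      · simpa using sub_eq_zero.1 h6
      · exact absurd h6 h0
    have htop : (Pi.single b 1 : ι → ℂ) ∈ fixSub u ⊔ fixSub (u⁻¹ * c) := by
      rw [h1.sup_eq_top]; trivial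
    obtain ⟨y, hy, z, hz, hyz⟩ := Submodule.mem_sup.1 htop
    have := congrFun hyz b
    rw [Pi.add_apply, zero_of u h3 h4 y hy, zero_of _ hp hw z hz, Pi.single_eq_same] at this
    simp at this
  · intro v hv
    simp only [Finset.mem_filter, Finset.mem_univ, true_and] at hv ⊢
    obtain ⟨⟨h1, h2⟩, h3⟩ := hv
    refine ⟨⟨?_, by rw [map_mul, map_inv, h2, h.weight_eq]; simp⟩, ?_, ?_⟩
    · unfold CodimLE at *
      have : (c * v⁻¹)⁻¹ * c = v := by group
      rw [this, codim_mul_comm, ← h1, add_comm]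
    · rw [mul_perm, Equiv.Perm.mul_apply, h3.inv.1, h.perm_fix]
    · rw [mul_wt, h3.inv.1, h3.inv.2, mul_one]
      exact h.wt_ne
  · intro u _; simp
  · intro v _; simp
  · intro u hu
    simp only [Finset.mem_filter, Finset.mem_univ, true_and] at hu
    have h1 := hu.1.1
    unfold CodimLE at h1
    rw [h.codim_eq] at h1
    change _ = reflect (l.length + 1) (X ^ codim (u⁻¹ * c))
    rw [reflect_monomial, revAt_le (by omega)]
    congr 1
    omega

theorem genOf_weight (h : IsCoxeterLike b l c) :
    genOf (fun u => weight u = 1) c = narQ l.length + (narQ l.length).reflect (l.length + 1) +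
      (l.length * Nat.card A : ℚ[X]) * X * narP l.length := by
  classical
  -- Whatever m and z are, the reflection joins b to the cycle, and dropping b then leaves a cycle
  -- through l of total weight 1.
  have h0 : ∀ m, m ≠ b → ∀ z : A, codim (refl b m z * c) + 1 = codim c ∧
      genOf (fun u => weight u = 1) (drop b (refl b m z * c)) = narP l.length := by
    intro m hm z
    have e1 : (refl b m z * c).perm b = m := by simp [h.perm_fix]
    have e2 : (drop b (refl b m z * c)).perm = l.formPerm := by
      rw [drop, e1]; simp [h.perm_eq]
    have e3 : ∀ j ∉ l, (drop b (refl b m z * c)).wt j = 1 := fun j hj => by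
      rw [h.eq_of_notMem hj]; exact (drop_fixesPt b _).2
    have e4 : weight (drop b (refl b m z * c)) = 1 := by
      rw [drop, e1, map_mul, map_mul, weight_refl hm, weight_refl hm, h.weight_eq]; simp
    have e5 := codim_of_perm_eq_formPerm h.nodup h.ne_nil e2 e3
    have e6 := gen_of_perm_eq_formPerm h.nodup h.ne_nil e2 e3
    rw [if_pos e4] at e5 e6
    have e7 := WeightedPerm.codim_drop (x := b) (w := refl b m z * c) fun hf =>
      hm (e1.symm.trans hf.1)
    refine ⟨by rw [h.codim_eq]; omega, ?_⟩
    rw [genOf_weight_eq_gen, e6]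
    have h2 : abs (drop b (refl b m z * c)) = abs c := by
      ext1
      · exact e2.trans h.perm_eq.symm
      · rfl
    have := h.codim_abs_add_one
    rw [h2]
    omega
  rw [genOf_eq (x := b) fun m hm z u _ => by rw [map_mul, weight_refl hm, one_mul]]
  congr 1
  · rw [← h.sum_not_fixesPt, ← h.sum_fixesPt,
      ← Finset.sum_filter_add_sum_filter_not _ (fun u => u.FixesPt b),
      Finset.filter_filter, Finset.filter_filter]
    congr 1
    · refine Finset.sum_congr (Finset.ext fun u => ?_) fun _ _ => rfl
      simp only [Finset.mem_filter, Finset.mem_univ, true_and]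
      unfold FixesPt
      tauto
    · refine Finset.sum_congr (Finset.ext fun u => ?_) fun _ _ => rfl
      simp only [Finset.mem_filter, Finset.mem_univ, true_and]
      unfold FixesPt
      tauto
  · have h1 : ∀ m ∈ Finset.univ.filter (· ≠ b), (∑ z with
        codim (refl b m z * c) + 1 = codim c,
        genOf (fun u => weight u = 1) (drop b (refl b m z * c))) =
          (Nat.card A : ℚ[X]) * narP l.length := by
      intro m hm
      have hm : m ≠ b := by simpa using hm
      rw [Finset.filter_true_of_mem fun z _ => (h0 m hm z).1,
        Finset.sum_congr rfl fun z _ => (h0 m hm z).2, Finset.sum_const, Finset.card_univ,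
        nsmul_eq_mul, Nat.card_eq_fintype_card]
    rw [Finset.sum_congr rfl h1, Finset.sum_const, nsmul_eq_mul]
    have h2 : (Finset.univ.filter (· ≠ b)) = l.toFinset := by
      ext j; simp [h.mem_iff]
    rw [h2, List.toFinset_card_of_nodup h.nodup]
    ring

omit [Fintype A] in
/-- Elements of weight `1` below `c` are products of as many reflections as their codimension. -/
theorem exists_factorization (h : IsCoxeterLike b l c) {u : WeightedPerm ι A}
    (hu : CodimLE u c) (hW : weight u = 1) :
    ∃ L : List (WeightedPerm ι A), L.prod = u ∧ L.length = codim u ∧ ∀ t ∈ L, IsWtReflection t := by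
  refine WeightedPerm.exists_factorization ?_ hW
  have h1 := hu.excess_add_le
  have h2 := h.codim_abs_add_one
  have h3 := h.codim_eq
  omega

end IsCoxeterLike

end WeightedPerm

/-! ### The group `G(d,d,n)` as a group of weighted permutations -/

namespace Gddn

open WeightedPerm Polynomial

variable {d n : ℕ}

/-- The weighted permutations with weights in the `d`-th roots of unity. -/
abbrev WP (d n : ℕ) : Type := WeightedPerm (Fin n) (rootsOfUnity d ℂ)

theorem coe_pow_eq_one (a : rootsOfUnity d ℂ) : ((a : ℂˣ) : ℂ) ^ d = 1 := by
  have := (mem_rootsOfUnity d _).1 a.2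
  rw [← Units.val_pow_eq_pow_val, this, Units.val_one]

noncomputable instance [NeZero d] : Fintype (rootsOfUnity d ℂ) := Fintype.ofFinite _

/-- The matrix of a weighted permutation. -/
def toMatrix (w : WP d n) : Matrix (Fin n) (Fin n) ℂ :=
  monomialMatrix w.perm fun j => ((w.wt j : ℂˣ) : ℂ)

theorem toMatrix_apply (w : WP d n) (i j : Fin n) :
    toMatrix w i j = if i = w.perm j then ((w.wt j : ℂˣ) : ℂ) else 0 := rfl

theorem toMatrix_injective : Function.Injective (toMatrix : WP d n → _) := by
  intro u v h
  have h1 : ∀ j, u.perm j = v.perm j := by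
    intro j
    have := congrFun (congrFun h (u.perm j)) j
    rw [toMatrix_apply, toMatrix_apply, if_pos rfl] at this
    by_contra hne
    rw [if_neg hne] at this
    exact Units.ne_zero _ this
  ext1
  · exact Equiv.ext h1
  · funext j
    have := congrFun (congrFun h (u.perm j)) j
    rw [toMatrix_apply, toMatrix_apply, if_pos rfl, if_pos (h1 j)] at this
    exact Subtype.ext (Units.ext this)

theorem toMatrix_mul (u v : WP d n) : toMatrix (u * v) = toMatrix u * toMatrix v := by
  ext i j
  rw [Matrix.mul_apply, Finset.sum_eq_single (v.perm j)]
  · rw [toMatrix_apply, toMatrix_apply, toMatrix_apply, if_pos rfl]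
    by_cases h : i = (u * v).perm j
    · rw [if_pos h, if_pos (show i = u.perm (v.perm j) from h)]; simp
    · rw [if_neg h, if_neg (show ¬ i = u.perm (v.perm j) from h), zero_mul]
  · intro k _ hk
    rw [toMatrix_apply v, if_neg hk, mul_zero]
  · simp

theorem toMatrix_one : toMatrix (1 : WP d n) = 1 := by
  ext i j
  rw [toMatrix_apply, Matrix.one_apply]
  by_cases h : i = j
  · rw [if_pos h, if_pos (show i = (1 : WP d n).perm j from h)]; simp
  · rw [if_neg h, if_neg (show ¬ i = (1 : WP d n).perm j from h)]

variable [NeZero d]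

theorem star_toMatrix (w : WP d n) : star (toMatrix w) = toMatrix w⁻¹ := by
  ext i j
  have hij : i = (w⁻¹).perm j ↔ w.perm i = j := Equiv.Perm.eq_inv_iff_eq
  rw [Matrix.star_apply, toMatrix_apply, toMatrix_apply]
  by_cases h : w.perm i = j
  · have hn : ‖((w.wt i : ℂˣ) : ℂ)‖ = 1 := by
      exact Complex.norm_eq_one_of_pow_eq_one (coe_pow_eq_one _) (NeZero.ne d)
    rw [if_pos h.symm, if_pos (hij.2 h), inv_wt]
    subst h
    have hi : w.perm⁻¹ (w.perm i) = i := by simp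
    rw [hi, InvMemClass.coe_inv, Units.val_inv_eq_inv_val, Complex.inv_def]
    simp [Complex.normSq_eq_norm_sq, hn]
  · rw [if_neg (fun e => h e.symm), if_neg fun e => h (hij.1 e), star_zero]

theorem toMatrix_mem (w : WP d n) : toMatrix w ∈ Matrix.unitaryGroup (Fin n) ℂ := by
  rw [Matrix.mem_unitaryGroup_iff, star_toMatrix, ← toMatrix_mul, mul_inv_cancel, toMatrix_one]

omit [NeZero d] in
theorem exists_toMatrix_eq (u : groupGddn d n) :
    ∃ w : WP d n, weight w = 1 ∧ toMatrix w = (u.1 : Matrix (Fin n) (Fin n) ℂ) := by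
  obtain ⟨u, σ, a, ha, ha', hu⟩ := u
  have h0 : ∀ j, a j ≠ 0 := fun j hj =>
    Finset.prod_ne_zero_iff.1 (ha'.trans_ne one_ne_zero) j (Finset.mem_univ j) hj
  refine ⟨⟨σ, fun j => ⟨Units.mk0 (a j) (h0 j), ?_⟩⟩, ?_, ?_⟩
  · rw [mem_rootsOfUnity]
    ext
    simpa using ha j
  · ext
    simp [weight_apply, ha']
  · rw [hu]; rfl

/-- The weighted permutation of an element of `G(d,d,n)`. -/
noncomputable def toWP : groupGddn d n →* WP d n where
  toFun u := (exists_toMatrix_eq u).choose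
  map_one' := by
    refine toMatrix_injective ?_
    rw [(exists_toMatrix_eq _).choose_spec.2, toMatrix_one]
    rfl
  map_mul' u v := by
    refine toMatrix_injective ?_
    rw [toMatrix_mul, (exists_toMatrix_eq _).choose_spec.2, (exists_toMatrix_eq _).choose_spec.2,
      (exists_toMatrix_eq _).choose_spec.2]
    rfl

omit [NeZero d] in
theorem toMatrix_toWP (u : groupGddn d n) :
    toMatrix (toWP u) = (u.1 : Matrix (Fin n) (Fin n) ℂ) := (exists_toMatrix_eq u).choose_spec.2

omit [NeZero d] in
@[simp] theorem weight_toWP (u : groupGddn d n) : weight (toWP u) = 1 :=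
  (exists_toMatrix_eq u).choose_spec.1

omit [NeZero d] in
theorem toWP_injective : Function.Injective (toWP : groupGddn d n → WP d n) := by
  intro u v h
  have := congrArg toMatrix h
  rw [toMatrix_toWP, toMatrix_toWP] at this
  exact Subtype.ext (Subtype.ext this)

theorem exists_toWP_eq {w : WP d n} (hw : weight w = 1) : ∃ u : groupGddn d n, toWP u = w := by
  refine ⟨⟨⟨toMatrix w, toMatrix_mem w⟩, w.perm, fun j => ((w.wt j : ℂˣ) : ℂ), ?_, ?_, rfl⟩, ?_⟩
  · exact fun j => coe_pow_eq_one _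
  · have := congrArg (fun a : rootsOfUnity d ℂ => ((a : ℂˣ) : ℂ)) hw
    simpa [weight_apply] using this
  · refine toMatrix_injective ?_
    rw [toMatrix_toWP]

omit [NeZero d] in
theorem fixedSpace_eq (u : groupGddn d n) : fixedSpace u.1 = fixSub (toWP u) := by
  ext x
  rw [fixedSpace, LinearMap.mem_ker, LinearMap.sub_apply, sub_eq_zero, ← toMatrix_toWP,
    mem_fixSub]
  have h1 : ∀ j, Matrix.toLin' (toMatrix (toWP u)) x ((toWP u).perm j) =
      (((toWP u).wt j : ℂˣ) : ℂ) * x j := by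
    intro j
    rw [Matrix.toLin'_apply, Matrix.mulVec, dotProduct, Finset.sum_eq_single j]
    · rw [toMatrix_apply, if_pos rfl]
    · intro k _ hk
      rw [toMatrix_apply, if_neg fun e => hk ((toWP u).perm.injective e).symm, zero_mul]
    · simp
  constructor
  · intro h j
    rw [← h1, h]; rfl
  · intro h
    funext i
    obtain ⟨j, rfl⟩ := (toWP u).perm.surjective i
    rw [h1, ← h j]; rfl

theorem isReflection_iff (u : groupGddn d n) : IsReflection u.1 ↔ IsWtReflection (toWP u) := by
  have h1 := codim_add_finrank (toWP u)
  rw [Fintype.card_fin] at h1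
  have h2 : IsOfFinOrder u.1 := by
    have : Finite (groupGddn d n) := Finite.of_injective _ toWP_injective
    exact Submonoid.isOfFinOrder_coe.2 (isOfFinOrder_of_finite u)
  rw [IsReflection, fixedSpace_eq, IsWtReflection]
  simp only [h2, weight_toWP, true_and, and_true]
  omega

omit [NeZero d] in
theorem one_absLE (u : groupGddn d n) : AbsLE (groupGddn d n) 1 u := by
  simp [AbsLE, absLength_one]

theorem codim_le_absLength (u : groupGddn d n) :
    (codim (toWP u) : ℕ∞) ≤ absLength (groupGddn d n) u := by
  refine le_sInf ?_
  rintro k ⟨l, hl, rfl, rfl⟩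
  have := le_length_of_prod_eq (L := l.map toWP) (by
    simp only [List.mem_map]
    rintro _ ⟨t, ht, rfl⟩
    exact (isReflection_iff t).1 (hl t ht))
  rw [List.length_map, ← map_list_prod] at this
  exact_mod_cast this

theorem absLength_eq {u : groupGddn d n} {L : List (WP d n)} (hL : L.prod = toWP u)
    (h : ∀ t ∈ L, IsWtReflection t) (hlen : L.length = codim (toWP u)) :
    absLength (groupGddn d n) u = codim (toWP u) := by
  refine le_antisymm (sInf_le ?_) (codim_le_absLength u)
  have hinv : ∀ t ∈ L, toWP (Function.invFun (toWP : groupGddn d n → _) t) = t :=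
    fun t ht => Function.invFun_eq (exists_toWP_eq (h t ht).2)
  refine ⟨L.map (Function.invFun (toWP : groupGddn d n → _)), ?_, ?_, ?_⟩
  · simp only [List.mem_map]
    rintro _ ⟨t, ht, rfl⟩
    rw [isReflection_iff, hinv t ht]
    exact h t ht
  · refine toWP_injective ?_
    rw [map_list_prod, List.map_map, ← hL]
    congr 1
    conv_rhs => rw [← List.map_id L]
    exact List.map_congr_left fun t ht => hinv t ht
  · rw [List.length_map, hlen]

section Coxeter

variable {b : Fin n} {l : List (Fin n)} {c : groupGddn d n}

theorem absLength_of_codimLE (hc : IsCoxeterLike b l (toWP c)) {u : groupGddn d n}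
    (hu : CodimLE (toWP u) (toWP c)) : absLength (groupGddn d n) u = codim (toWP u) := by
  obtain ⟨L, h1, h2, h3⟩ := hc.exists_factorization hu (weight_toWP u)
  exact absLength_eq h1 h3 h2

/-- Codimension bounds length from below for every element, and the two agree at c. If the lengths
of u and u⁻¹c add up to that of c, the codimensions are squeezed between this sum and
`codim_le_add`. Conversely, length equals codimension below c. -/
theorem absLE_iff (hc : IsCoxeterLike b l (toWP c)) (u : groupGddn d n) :
    AbsLE (groupGddn d n) u c ↔ CodimLE (toWP u) (toWP c) := by
  have hcc : absLength (groupGddn d n) c = codim (toWP c) :=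
    absLength_of_codimLE hc (by simp [CodimLE])
  rw [AbsLE, hcc]
  constructor
  · intro h
    have h1 := codim_le_absLength u
    have h2 := codim_le_absLength (u⁻¹ * c)
    have h3 := codim_le_add (toWP u) (toWP c)
    have h4 := add_le_add h1 h2
    rw [← h, map_mul, map_inv] at h4
    norm_cast at h4
    exact le_antisymm h4 h3
  · intro h
    have h1 := absLength_of_codimLE hc h
    have h2 := absLength_of_codimLE hc (u := u⁻¹ * c) (by
      rw [map_mul, map_inv]; exact h.kreweras)
    rw [h1, h2, map_mul, map_inv]
    exact_mod_cast h.symm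

/-- Codimension is strictly monotone, which bounds the height above. For a long chain, removing the
first reflection of a shortest factorization gives an element of codimension one less that is still
below c. -/
theorem height_eq (hc : IsCoxeterLike b l (toWP c)) (x : NCPartition (groupGddn d n) c) :
    Order.height x = codim (toWP x.1) := by
  have hlen : ∀ x : NCPartition (groupGddn d n) c,
      absLength (groupGddn d n) x.1 = codim (toWP x.1) := fun x =>
    absLength_of_codimLE hc ((absLE_iff hc x.1).1 x.2.2)
  refine le_antisymm ?_ ?_
  · have hmono : StrictMono fun x : NCPartition (groupGddn d n) c => codim (toWP x.1) := by
      intro x y hxy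
      have h1 : absLength _ y.1 = absLength _ x.1 + absLength _ (x.1⁻¹ * y.1) := hxy.le
      have h2 := codim_le_absLength (x.1⁻¹ * y.1)
      have h3 : codim (toWP (x.1⁻¹ * y.1)) ≠ 0 := by
        intro h0
        have h4 : x.1⁻¹ * y.1 = 1 := toWP_injective (by rw [codim_eq_zero h0, map_one])
        have h5 : x = y := Subtype.ext (inv_mul_eq_one.1 h4)
        exact lt_irrefl _ (h5 ▸ hxy)
      rw [hlen, hlen] at h1
      have h6 : ((codim (toWP x.1) + codim (toWP (x.1⁻¹ * y.1)) : ℕ) : ℕ∞) ≤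
          codim (toWP y.1) := by
        rw [h1]; push_cast; gcongr
      have := Nat.cast_le.1 h6
      change codim (toWP x.1) < codim (toWP y.1)
      omega
    have := Order.height_le_height_apply_of_strictMono _ hmono x
    simpa using this
  · induction hk : codim (toWP x.1) generalizing x with
    | zero => simp
    | succ k ih =>
      have hx := (absLE_iff hc x.1).1 x.2.2
      obtain ⟨L, h1, h2, h3⟩ := hc.exists_factorization hx (weight_toWP x.1)
      cases L with
      | nil => simp [hk] at h2
      | cons t L =>
        rw [List.length_cons, hk] at h2
        have hL : ∀ s ∈ L, IsWtReflection s := fun s hs => h3 s (by simp [hs])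
        obtain ⟨y, hy⟩ := exists_toWP_eq (weight_prod_eq_one hL)
        have ht := h3 t (by simp)
        rw [List.prod_cons] at h1
        have h4 : codim (toWP y) = k := by
          have e1 := le_length_of_prod_eq hL
          have e2 := codim_mul_le t L.prod
          rw [h1, hk, ht.1] at e2
          rw [hy]
          omega
        have h5 : toWP (y⁻¹ * x.1) = L.prod⁻¹ * t * L.prod⁻¹⁻¹ := by
          rw [map_mul, map_inv, hy, ← h1]; group
        have h6 : codim (toWP (y⁻¹ * x.1)) = 1 := by rw [h5, codim_conj, ht.1]
        have h7 : absLength (groupGddn d n) y = codim (toWP y) :=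
          absLength_eq hy.symm hL (by omega)
        have h8 : absLength (groupGddn d n) (y⁻¹ * x.1) = codim (toWP (y⁻¹ * x.1)) := by
          refine absLength_eq (L := [toWP (y⁻¹ * x.1)]) (List.prod_singleton) ?_ (by rw [h6]; rfl)
          intro s hs
          rw [List.mem_singleton] at hs
          rw [hs]
          exact ⟨h6, weight_toWP _⟩
        have h9 : AbsLE (groupGddn d n) y x.1 := by
          rw [AbsLE, hlen, h7, h8, h6, h4, hk]; norm_cast
        have h10 : CodimLE (toWP y) (toWP c) := by
          have e1 := codim_le_add (toWP y) (toWP c)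
          have e2 := codim_mul_le (toWP (y⁻¹ * x.1)) ((toWP x.1)⁻¹ * toWP c)
          have e3 : toWP (y⁻¹ * x.1) * ((toWP x.1)⁻¹ * toWP c) = (toWP y)⁻¹ * toWP c := by
            rw [map_mul, map_inv]; group
          rw [e3, h6] at e2
          unfold CodimLE at *
          omega
        let z : NCPartition (groupGddn d n) c :=
          ⟨y, one_absLE y, (absLE_iff hc y).2 h10⟩
        have hz : z < x := by
          refine lt_of_le_not_ge h9 fun h => ?_
          have h : absLength _ y = absLength _ x.1 + absLength _ (x.1⁻¹ * y) := h
          rw [h7, hlen, h4, hk] at h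
          have := (le_self_add (a := ((k + 1 : ℕ) : ℕ∞))).trans h.ge
          have := Nat.cast_le.1 this
          omega
        have h11 := ih z h4
        calc ((k + 1 : ℕ) : ℕ∞) = k + 1 := by push_cast; rfl
          _ ≤ Order.height z + 1 := by gcongr
          _ ≤ Order.height x := Order.height_add_one_le hz

theorem rankNumber_eq (hc : IsCoxeterLike b l (toWP c)) (k : ℕ) :
    (rankNumber (NCPartition (groupGddn d n) c) k : ℚ) =
      (narQ l.length + (narQ l.length).reflect (l.length + 1) +
        (l.length * d : ℚ[X]) * X * narP l.length).coeff k := by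
  classical
  have hcard : Nat.card (rootsOfUnity d ℂ) = d := by
    rw [Complex.card_rootsOfUnity]
  have h1 := hc.genOf_weight
  rw [hcard] at h1
  rw [← h1, genOf, finsetSum_coeff]
  simp only [coeff_X_pow]
  rw [← Finset.sum_filter, Finset.sum_const, nsmul_eq_mul, mul_one, Finset.filter_filter,
    rankNumber]
  congr 1
  rw [← Fintype.card_subtype, ← Nat.card_eq_fintype_card]
  refine Nat.card_congr (Equiv.ofBijective (fun x => ⟨toWP x.1.1,
    ⟨(absLE_iff hc x.1.1).1 x.1.2.2, weight_toWP _⟩, ?_⟩) ⟨?_, ?_⟩)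
  · have := x.2
    rw [height_eq hc] at this
    exact_mod_cast this.symm
  · intro x y hxy
    exact Subtype.ext (Subtype.ext (toWP_injective (congrArg Subtype.val hxy)))
  · rintro ⟨w, ⟨hw, hw1⟩, hk⟩
    obtain ⟨u, rfl⟩ := exists_toWP_eq hw1
    refine ⟨⟨⟨u, one_absLE u, (absLE_iff hc u).2 hw⟩, ?_⟩, rfl⟩
    exact (height_eq hc _).trans (by rw [hk])

end Coxeter

end Gddn

/-! ### Coxeter elements of `G(d,d,n)` -/

namespace Gddn

open WeightedPerm

variable {d n : ℕ}

/-- `v` satisfies the eigenvector equation of `w` for `ζ`. -/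
def IsEig (w : WP d n) (ζ : ℂ) (v : Fin n → ℂ) : Prop :=
  ∀ j, ((w.wt j : ℂˣ) : ℂ) * v j = ζ * v (w.perm j)

theorem toMatrix_mulVec_perm (w : WP d n) (v : Fin n → ℂ) (j : Fin n) :
    ∑ k, toMatrix w (w.perm j) k * v k = ((w.wt j : ℂˣ) : ℂ) * v j := by
  rw [Finset.sum_eq_single j]
  · rw [toMatrix_apply, if_pos rfl]
  · intro k _ hk
    rw [toMatrix_apply, if_neg fun e => hk (w.perm.injective e).symm, zero_mul]
  · simp

theorem IsEig.sum_eq {w : WP d n} {ζ : ℂ} {v : Fin n → ℂ} (h : IsEig w ζ v) (i : Fin n) :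
    ∑ k, toMatrix w i k * v k = ζ * v i := by
  obtain ⟨j, rfl⟩ := w.perm.surjective i
  rw [toMatrix_mulVec_perm, h j]

theorem IsEig.pow {w : WP d n} {ζ : ℂ} {v : Fin n → ℂ} (h : IsEig w ζ v) (k : ℕ) :
    IsEig (w ^ k) (ζ ^ k) v := by
  induction k with
  | zero => intro j; simp
  | succ k ih =>
    intro j
    rw [pow_succ, pow_succ, mul_wt, mul_perm, Subgroup.coe_mul, Units.val_mul, mul_assoc, h j,
      mul_left_comm, ih (w.perm j), Equiv.Perm.mul_apply]
    ring

theorem isEig_of_hasEigenvector {c : groupGddn d n} {ζ : ℂ} {v : Fin n → ℂ}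
    (h : Module.End.HasEigenvector (Matrix.toLin' (c.1 : Matrix (Fin n) (Fin n) ℂ)) ζ v) :
    IsEig (toWP c) ζ v := by
  intro j
  have h1 := congrFun h.apply_eq_smul ((toWP c).perm j)
  rw [Matrix.toLin'_apply, Matrix.mulVec, dotProduct, ← toMatrix_toWP, toMatrix_mulVec_perm] at h1
  simpa using h1

/-! ### A lower bound for the largest degree. -/

section Degrees

open MvPolynomial

theorem aeval_smul_of_isHomogeneous {f : MvPolynomial (Fin n) ℂ} {δ : ℕ} (hf : f.IsHomogeneous δ)
    (t : ℂ) (v : Fin n → ℂ) : aeval (fun i => t * v i) f = t ^ δ * aeval v f := by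
  rw [aeval_def, aeval_def, eval₂_eq', eval₂_eq', Finset.mul_sum]
  refine Finset.sum_congr rfl fun s hs => ?_
  have h1 : ∑ i, s i = δ := by
    have := hf (mem_support_iff.1 hs)
    rw [Finsupp.weight_apply, Finsupp.sum_fintype _ _ (by simp)] at this
    simpa using this
  simp only [mul_pow, Finset.prod_mul_distrib, Finset.prod_pow_eq_pow_sum, h1]
  ring

theorem aeval_eq_of_invariant {f : MvPolynomial (Fin n) ℂ} {u : groupGddn d n} {ζ : ℂ}
    {v : Fin n → ℂ} (hf : IsInvariantPolynomial (groupGddn d n) f) (hv : IsEig (toWP u) ζ v) :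
    aeval (fun i => ζ * v i) f = aeval v f := by
  have h1 := congrArg (aeval v) (hf u.1 u.2)
  rw [comp_aeval_apply] at h1
  rw [← h1]
  congr 2
  funext i
  rw [map_sum, ← hv.sum_eq i, ← toMatrix_toWP]
  refine Finset.sum_congr rfl fun k _ => ?_
  simp

/-- A vector and an element with an eigenvalue of order `(n - 1) d`. -/
theorem exists_isEig (hd : d ≠ 0) (M : ℕ) : ∃ (u : groupGddn d (M + 2)) (ζ : ℂ)
    (v : Fin (M + 2) → ℂ), IsPrimitiveRoot ζ ((M + 1) * d) ∧ IsEig (toWP u) ζ v ∧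
      ∑ j, v j ^ ((M + 1) * d) = M + 1 := by
  have : NeZero d := ⟨hd⟩
  have h0 : (M + 1) * d ≠ 0 := by positivity
  have hζ := Complex.isPrimitiveRoot_exp _ h0
  set ζ : ℂ := Complex.exp (2 * Real.pi * Complex.I / ((M + 1) * d : ℕ))
  have hζ0 : ζ ≠ 0 := Complex.exp_ne_zero _
  have hω : (ζ ^ (M + 1)) ^ d = 1 := by rw [← pow_mul, hζ.pow_eq_one]
  -- The element is the cycle through 0, ..., M with the weight ω = ζ^(M+1) at M, and ω⁻¹ at the
  -- remaining fixed point. Its eigenvector has the entries ζ⁻ʲ on the cycle and 0 at the fixed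
  -- point.
  let m : Fin (M + 2) := (Fin.last M).castSucc
  have hm : m ≠ Fin.last _ := (Fin.castSucc_lt_last _).ne
  let ω : rootsOfUnity d ℂ := rootsOfUnity.mkOfPowEq (ζ ^ (M + 1)) hω
  let w : WP d (M + 2) := ⟨Fin.cycleRange m, fun j =>
    (if j = m then ω else 1) * if j = Fin.last _ then ω⁻¹ else 1⟩
  have hw : weight w = 1 := by
    simp only [weight_apply, w, Finset.prod_mul_distrib]
    simp
  obtain ⟨u, hu⟩ := exists_toWP_eq hw
  refine ⟨u, ζ, fun j => if j = Fin.last _ then 0 else ζ⁻¹ ^ (j : ℕ), hζ, ?_, ?_⟩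
  · rw [hu]
    intro j
    rcases lt_trichotomy j m with hj | rfl | hj
    · have h1 : j ≠ Fin.last _ := (hj.trans (Fin.castSucc_lt_last _)).ne
      have h2 : ((Fin.cycleRange m j : Fin (M + 2)) : ℕ) = j + 1 := Fin.coe_cycleRange_of_lt hj
      have h3 : Fin.cycleRange m j ≠ Fin.last _ := by
        intro h
        have h4 := congrArg Fin.val h
        rw [h2] at h4
        have h5 : (j : ℕ) < M := hj
        simp at h4
        omega
      simp only [w, hj.ne, h1, h3, h2, if_false, mul_one]
      simp only [OneMemClass.coe_one, Units.val_one, one_mul]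
      rw [pow_succ]
      field_simp
    · have h1 : ((m : Fin (M + 2)) : ℕ) = M := rfl
      have h2 : (0 : Fin (M + 2)) ≠ Fin.last _ := (Fin.last_pos).ne
      simp only [w, Fin.cycleRange_self, hm, h2, if_true, if_false, mul_one, h1]
      simp only [ω, rootsOfUnity.val_mkOfPowEq_coe, Fin.val_zero, pow_zero]
      rw [pow_succ, inv_pow]
      field_simp
    · have h1 : j = Fin.last _ := by
        have h2 : M < (j : ℕ) := hj
        ext
        have := j.2
        simp
        omega
      have h2 : Fin.cycleRange m j = j := Fin.cycleRange_of_gt hj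
      simp only [w, h2]
      simp [h1]
  · rw [Fin.sum_univ_castSucc]
    simp only [Fin.castSucc_ne_last, if_false, if_true, zero_pow h0, add_zero]
    rw [Finset.sum_congr rfl (g := fun _ => (1 : ℂ))]
    · simp
    · intro j _
      rw [← pow_mul, mul_comm, pow_mul, inv_pow, hζ.pow_eq_one]
      simp

theorem powerSum_invariant {k : ℕ} (hk : d ∣ k) :
    IsInvariantPolynomial (groupGddn d n) (∑ j, X j ^ k) := by
  intro u hu
  obtain ⟨q, rfl⟩ := hk
  have h1 : ∀ j, ∑ i, C ((u : Matrix (Fin n) (Fin n) ℂ) ((toWP ⟨u, hu⟩).perm j) i) * X i =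
      C (((toWP ⟨u, hu⟩ : WP d n).wt j : ℂˣ) : ℂ) * (X j : MvPolynomial (Fin n) ℂ) := by
    intro j
    have h2 : (u : Matrix (Fin n) (Fin n) ℂ) = toMatrix (toWP ⟨u, hu⟩) := (toMatrix_toWP (⟨u, hu⟩ : groupGddn d n)).symm
    rw [Finset.sum_eq_single j]
    · rw [h2, toMatrix_apply, if_pos rfl]
    · intro k _ hk
      rw [h2, toMatrix_apply, if_neg fun e => hk ((toWP ⟨u, hu⟩).perm.injective e).symm]
      simp
    · simp
  rw [map_sum, ← Equiv.sum_comp (toWP ⟨u, hu⟩).perm]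
  refine Finset.sum_congr rfl fun j _ => ?_
  rw [map_pow, aeval_X, h1, mul_pow, ← C_pow, pow_mul, coe_pow_eq_one, one_pow, C_1, one_mul]

/-- Let ζ and v be as in `exists_isEig`. A basic invariant f of degree δ has f(v) = f(ζv) = ζ^δ
f(v), so f(v) = f(0) if δ is below the order of ζ. Were this so for all basic invariants, every
invariant would agree at v and 0, but the power sum of exponent (M+1)d does not. -/
theorem le_of_isCoxeterNumber (hd : d ≠ 0) {M h : ℕ}
    (hh : IsCoxeterNumber (groupGddn d (M + 2)) h) : (M + 1) * d ≤ h := by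
  by_contra hlt
  obtain ⟨δ, ⟨f, -, hhom, hadj⟩, -, hub⟩ := hh
  obtain ⟨u, ζ, v, hζ, hv, hsum⟩ := exists_isEig hd M
  have key : ∀ i, aeval v (f i) = aeval (0 : Fin (M + 2) → ℂ) (f i) := by
    intro i
    have h1 := aeval_smul_of_isHomogeneous (hhom i) 0 v
    have h2 := aeval_smul_of_isHomogeneous (hhom i) ζ v
    have h3 : IsInvariantPolynomial (groupGddn d (M + 2)) (f i) :=
      (hadj _).1 (Algebra.subset_adjoin ⟨i, rfl⟩)
    rw [aeval_eq_of_invariant h3 hv] at h2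
    have h4 : (0 : Fin (M + 2) → ℂ) = fun i => 0 * v i := by funext; simp
    rw [h4, h1]
    have h5 : δ i ≤ h := hub ⟨i, rfl⟩
    by_cases h0 : δ i = 0
    · rw [h0]; simp
    · have h6 : ζ ^ δ i ≠ 1 := hζ.pow_ne_one_of_pos_of_lt h0 (by omega)
      have h7 : (ζ ^ δ i - 1) * aeval v (f i) = 0 := by linear_combination -h2
      rw [zero_pow h0, zero_mul]
      exact (mul_eq_zero.1 h7).resolve_left (sub_ne_zero.2 h6)
  have hle : Algebra.adjoin ℂ (Set.range f) ≤
      AlgHom.equalizer (aeval v) (aeval (0 : Fin (M + 2) → ℂ)) := by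
    rw [Algebra.adjoin_le_iff]
    rintro _ ⟨i, rfl⟩
    exact key i
  have h1 := hle ((hadj _).2 (powerSum_invariant (d := d) (k := (M + 1) * d) (dvd_mul_left _ _)))
  have h0 : (M + 1) * d ≠ 0 := by positivity
  rw [AlgHom.mem_equalizer] at h1
  simp only [map_sum, map_pow, aeval_X, Pi.zero_apply, zero_pow h0, Finset.sum_const_zero] at h1
  rw [hsum] at h1
  norm_cast at h1

end Degrees

theorem pow_eq_one_of_perm_eq_one {w : WP d n} (h : w.perm = 1) : w ^ d = 1 := by
  have h1 : ∀ k, (w ^ k).perm = 1 ∧ ∀ j, (w ^ k).wt j = w.wt j ^ k := by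
    intro k
    induction k with
    | zero => exact ⟨rfl, fun j => by simp⟩
    | succ k ih =>
      refine ⟨by rw [pow_succ, mul_perm, ih.1, h, one_mul], fun j => ?_⟩
      rw [pow_succ, mul_wt, ih.2, h, pow_succ]
      rfl
  refine eq_one_of_fixesPt fun j => ⟨by rw [(h1 d).1]; rfl, ?_⟩
  rw [(h1 d).2]
  ext
  simpa using coe_pow_eq_one (w.wt j)

/-! ### The shape of Coxeter elements. -/

variable [NeZero d]

/-- Equal d-th powers make v j a root-of-unity multiple of v i, and v then lies in the hyperplane of
some `refl i j z`. -/
theorem ne_of_isRegularVector {v : Fin n → ℂ} (hv : IsRegularVector (groupGddn d n) v)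
    {i j : Fin n} (h : v i ^ d = v j ^ d) : i = j := by
  by_contra hij
  have hne : ∀ z : rootsOfUnity d ℂ, v j ≠ ((z : ℂˣ) : ℂ) * v i := by
    intro z hz
    have hji : j ≠ i := fun e => hij e.symm
    obtain ⟨t, ht⟩ := exists_toWP_eq (weight_refl hji z : weight (refl i j z : WP d n) = 1)
    have h1 : IsReflection t.1 := by
      rw [isReflection_iff, ht]; exact isWtReflection_refl hji z
    refine hv t.1 t.2 h1 ?_
    rw [fixedSpace_eq, ht]
    exact mem_fixSub_refl hz
  by_cases hi : v i = 0
  · rw [hi, zero_pow (NeZero.ne d)] at h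
    have hj : v j = 0 := pow_eq_zero_iff (NeZero.ne d) |>.1 h.symm
    exact hne 1 (by simp [hi, hj])
  · have h1 : (v j / v i) ^ d = 1 := by
      rw [div_pow, ← h, div_self (pow_ne_zero _ hi)]
    refine hne (rootsOfUnity.mkOfPowEq _ h1) ?_
    rw [rootsOfUnity.val_mkOfPowEq_coe]
    field_simp

/-- The d-th powers of the coordinates of a regular eigenvector are distinct, so at most one
coordinate vanishes, and the permutation of a power of w is trivial once ζ^(kd) = 1. The lower bound
(M+1)d for the order of w then forces the cycle type. -/
theorem exists_isCoxeterLike (hd : 2 ≤ d) {M : ℕ} {c : groupGddn d (M + 2)}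
    (hc : IsCoxeterElement (groupGddn d (M + 2)) c) :
    ∃ b l, IsCoxeterLike b l (toWP c) ∧ l.length = M + 1 := by
  obtain ⟨h, hh, hord, ζ, hζ, v, hv, hreg⟩ := hc
  have hle := le_of_isCoxeterNumber (NeZero.ne d) hh
  have hE := isEig_of_hasEigenvector hv
  set w := toWP c with hw
  have hord' : orderOf w = h := by rw [hw, orderOf_injective _ toWP_injective, hord]
  have hmin : ∀ k, 0 < k → w ^ k = 1 → (M + 1) * d ≤ k := fun k hk hk1 =>
    hle.trans (hord' ▸ orderOf_le_of_pow_eq_one hk hk1)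
  have hpos : 0 < h := lt_of_lt_of_le (by positivity) hle
  have hζ0 : ζ ≠ 0 := by
    rintro rfl
    rw [zero_pow hpos.ne'] at hζ
    exact zero_ne_one hζ
  have hinj : ∀ {i j}, v i ^ d = v j ^ d → i = j := ne_of_isRegularVector hreg
  have hz : ∀ k j, v j ^ d = ζ ^ (k * d) * v ((w ^ k).perm j) ^ d := by
    intro k j
    have := congrArg (· ^ d) (hE.pow k j)
    simp only [mul_pow, coe_pow_eq_one, one_mul, ← pow_mul] at this
    exact this
  have hperm : ∀ k, ζ ^ (k * d) = 1 → (w ^ k).perm = 1 := by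
    intro k hk
    ext j
    have := hz k j
    rw [hk, one_mul] at this
    rw [← hinj this]
    rfl
  have hwt : ∀ k j, (w ^ k).perm = 1 → v j ≠ 0 → (((w ^ k).wt j : ℂˣ) : ℂ) = ζ ^ k := by
    intro k j hk hj
    have := hE.pow k j
    rw [hk] at this
    exact mul_right_cancel₀ hj this
  have hW : ∏ j, ((w.wt j : ℂˣ) : ℂ) = 1 := by
    have := congrArg (fun a : rootsOfUnity d ℂ => ((a : ℂˣ) : ℂ)) (weight_toWP c)
    simpa [weight_apply] using this
  by_cases hall : ∀ j, v j ≠ 0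
  -- Multiplying the eigenvector equations gives ζ^n = 1 for n = M + 2, whence w^n = 1 and (n-1)d ≤
  -- n. Only n = d = 2 survives.
  · have h1 : ζ ^ (M + 2) = 1 := by
      have h2 : ∏ j, (((w.wt j : ℂˣ) : ℂ) * v j) = ∏ j, (ζ * v (w.perm j)) :=
        Finset.prod_congr rfl fun j _ => hE j
      rw [Finset.prod_mul_distrib, Finset.prod_mul_distrib, hW, Finset.prod_const,
        Equiv.prod_comp w.perm v, Finset.card_univ, Fintype.card_fin] at h2
      exact (mul_right_cancel₀ (Finset.prod_ne_zero_iff.2 fun j _ => hall j) h2).symm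
    have h2 : (w ^ (M + 2)).perm = 1 := hperm _ (by rw [pow_mul, h1, one_pow])
    have h3 : w ^ (M + 2) = 1 := by
      refine eq_one_of_fixesPt fun j => ⟨by rw [h2]; rfl, ?_⟩
      ext
      rw [hwt _ j h2 (hall j), h1]; simp
    have h4 := hmin _ (by omega) h3
    have hM : M = 0 := by nlinarith
    subst hM
    have hd2 : d = 2 := by omega
    have h5 : w.perm = 1 := by
      have := hperm 1 (by rw [one_mul, hd2]; exact h1)
      simpa using this
    refine ⟨0, [1], ⟨by simp, by simp, ?_, by simpa using h5, ?_, weight_toWP c⟩, rfl⟩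
    · intro j; fin_cases j <;> simp
    · intro h0
      have h6 := hwt 1 0 (by simpa using h5) (hall 0)
      rw [pow_one, pow_one, h0] at h6
      have h7 : w = 1 := eq_one_of_fixesPt fun j => ⟨by rw [h5]; rfl, by
        ext
        have := hwt 1 j (by simpa using h5) (hall j)
        rw [pow_one, pow_one, ← h6] at this
        simpa using this⟩
      have := hmin 1 one_pos (by rw [h7, one_pow])
      omega
  · push Not at hall
    obtain ⟨b, hb⟩ := hall
    have hne : ∀ j, j ≠ b → v j ≠ 0 := fun j hj h0 => hj (hinj (by rw [h0, hb]))
    have hσb : w.perm b = b := by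
      have h1 := hE b
      rw [hb, mul_zero, eq_comm, mul_eq_zero] at h1
      exact hinj (by rw [h1.resolve_left hζ0, hb])
    have hσ : ∀ k, (w ^ k).perm b = b := by
      intro k
      induction k with
      | zero => rfl
      | succ k ih => rw [pow_succ, mul_perm, Equiv.Perm.mul_apply, hσb, ih]
    have hprod : ∏ j ∈ Finset.univ.erase b, ((w.wt j : ℂˣ) : ℂ) = ζ ^ (M + 1) := by
      have h2 : ∏ j ∈ Finset.univ.erase b, (((w.wt j : ℂˣ) : ℂ) * v j) =
          ∏ j ∈ Finset.univ.erase b, (ζ * v (w.perm j)) := Finset.prod_congr rfl fun j _ => hE j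
      have h3 : ∏ j ∈ Finset.univ.erase b, v (w.perm j) = ∏ j ∈ Finset.univ.erase b, v j := by
        refine Finset.prod_bij (fun j _ => w.perm j) ?_ (fun _ _ _ _ e => w.perm.injective e) ?_
          fun _ _ => rfl
        · intro j hj
          refine Finset.mem_erase.2 ⟨fun e => (Finset.mem_erase.1 hj).1 ?_, Finset.mem_univ _⟩
          exact w.perm.injective (e.trans hσb.symm)
        · intro j hj
          obtain ⟨i, rfl⟩ := w.perm.surjective j
          refine ⟨i, Finset.mem_erase.2 ⟨?_, Finset.mem_univ _⟩, rfl⟩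
          rintro rfl
          exact (Finset.mem_erase.1 hj).1 hσb
      rw [Finset.prod_mul_distrib, Finset.prod_mul_distrib, h3, Finset.prod_const,
        Finset.card_erase_of_mem (Finset.mem_univ b), Finset.card_univ, Fintype.card_fin] at h2
      exact mul_right_cancel₀ (Finset.prod_ne_zero_iff.2 fun j hj =>
        hne j (Finset.mem_erase.1 hj).1) h2
    have hb1 : ((w.wt b : ℂˣ) : ℂ) * ζ ^ (M + 1) = 1 := by
      rw [← hprod, Finset.mul_prod_erase _ (fun j => ((w.wt j : ℂˣ) : ℂ)) (Finset.mem_univ b), hW]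
    have hNd : ζ ^ ((M + 1) * d) = 1 := by
      have := congrArg (· ^ d) hb1
      simpa [mul_pow, coe_pow_eq_one, ← pow_mul] using this
    have hN := hperm _ hNd
    -- A trivial weight at b would give ζ^(M+1) = 1 and w^(M+1) = 1, against the bound on the order.
    have hwb : w.wt b ≠ 1 := by
      intro h0
      have h1 : ζ ^ (M + 1) = 1 := by simpa [h0] using hb1
      have h2 : ∀ k, (w ^ k).wt b = 1 := by
        intro k
        induction k with
        | zero => rfl
        | succ k ih => rw [pow_succ, mul_wt, hσb, ih, h0, one_mul]
      have h3 : w ^ (M + 1) = 1 := by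
        refine eq_one_of_fixesPt fun j => ⟨by rw [hN]; rfl, ?_⟩
        by_cases hj : j = b
        · rw [hj, h2]
        · ext
          rw [hwt _ j hN (hne j hj), h1]; simp
      have := hmin _ (by omega) h3
      nlinarith
    -- A return after q steps makes w^q diagonal, so w^(qd) = 1 and the order bound gives q ≥ M+1.
    -- Thus all indices other than b form a single cycle.
    have hq : ∀ q, 0 < q → ∀ x, x ≠ b → (w ^ q).perm x = x → M + 1 ≤ q := by
      intro q hq x hx hxq
      have h1 := hz q x
      rw [hxq] at h1
      have h2 : ζ ^ (q * d) = 1 := by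
        have : v x ^ d ≠ 0 := pow_ne_zero _ (hne x hx)
        exact mul_right_cancel₀ this (by rw [← h1, one_mul])
      have h3 := pow_eq_one_of_perm_eq_one (hperm q h2)
      rw [← pow_mul] at h3
      exact Nat.le_of_mul_le_mul_right (hmin _ (by positivity) h3) (by omega)
    obtain ⟨x, hx⟩ := exists_ne b
    have hxb : ∀ i, (w ^ i).perm x ≠ b := fun i e =>
      hx ((w ^ i).perm.injective (e.trans (hσ i).symm))
    have hlt : ∀ i j, i < j → j < M + 1 → (w ^ i).perm x ≠ (w ^ j).perm x := by
      intro i j hij hj e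
      have h1 : (w ^ j).perm x = (w ^ i).perm ((w ^ (j - i)).perm x) := by
        rw [← Equiv.Perm.mul_apply, ← mul_perm, ← pow_add]
        congr 3
        omega
      rw [h1] at e
      have := hq (j - i) (by omega) x hx ((w ^ i).perm.injective e).symm
      omega
    set l : List (Fin (M + 2)) := (List.range (M + 1)).map fun i => (w ^ i).perm x with hl
    have hnd : l.Nodup := by
      refine List.Nodup.map_on ?_ List.nodup_range
      intro i hi j hj e
      rw [List.mem_range] at hi hj
      rcases lt_trichotomy i j with h1 | h1 | h1
      · exact absurd e (hlt i j h1 hj)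
      · exact h1
      · exact absurd e.symm (hlt j i h1 hi)
    have hlen : l.length = M + 1 := by simp [hl]
    have hget : ∀ i (hi : i < l.length), l[i] = (w ^ i).perm x := by
      intro i hi
      simp [hl]
    have hmem : ∀ j, j ∈ l ↔ j ≠ b := by
      have h1 : l.toFinset = Finset.univ.erase b := by
        refine Finset.eq_of_subset_of_card_le ?_ ?_
        · intro j hj
          rw [List.mem_toFinset, hl, List.mem_map] at hj
          obtain ⟨i, -, rfl⟩ := hj
          exact Finset.mem_erase.2 ⟨hxb i, Finset.mem_univ _⟩
        · rw [List.toFinset_card_of_nodup hnd, hlen,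
            Finset.card_erase_of_mem (Finset.mem_univ b), Finset.card_univ, Fintype.card_fin]
          omega
      intro j
      rw [← List.mem_toFinset, h1]
      simp
    refine ⟨b, l, ⟨hnd, ?_, hmem, ?_, hwb, weight_toWP c⟩, hlen⟩
    · intro h0
      rw [h0] at hlen
      simp at hlen
    · ext1 j
      by_cases hj : j = b
      · rw [hj, hσb, List.formPerm_apply_of_notMem fun h => (hmem b).1 h rfl]
      · obtain ⟨i, hi, rfl⟩ := List.mem_iff_getElem.1 ((hmem j).2 hj)
        rw [List.formPerm_apply_getElem _ hnd, hget, hget]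
        have h1 : w.perm ((w ^ i).perm x) = (w ^ (i + 1)).perm x := by
          rw [pow_succ', mul_perm, Equiv.Perm.mul_apply]
        rw [h1, hlen]
        rw [hlen] at hi
        rcases Nat.lt_or_ge (i + 1) (M + 1) with h2 | h2
        · rw [Nat.mod_eq_of_lt h2]
        · have h3 : i + 1 = M + 1 := by omega
          rw [h3, Nat.mod_self, hN]
          rfl

end Gddn

/-! ### Narayana polynomials -/

section Narayana

open Polynomial

theorem narP_succ (M : ℕ) :
    narP (M + 1) = narP M + X * ∑ i ∈ Finset.range M, narP i * narP (M - i) := by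
  rw [narP, Fin.sum_univ_eq_sum_range fun i => narP i * narP (M - i)]

theorem narQ_succ (M : ℕ) :
    narQ (M + 1) = narQ M +
      X * ∑ i ∈ Finset.range M, (narP i * narQ (M - i) + narQ i * narP (M - i)) := by
  rw [narQ, Fin.sum_univ_eq_sum_range fun i => narP i * narQ (M - i) + narQ i * narP (M - i)]

@[simp] theorem narP_zero : narP 0 = 1 := by rw [narP]
@[simp] theorem narQ_zero : narQ 0 = 1 := by rw [narQ]

/-- The generating function of the Narayana polynomials. -/
noncomputable def narSeries : PowerSeries ℚ[X] := PowerSeries.mk narP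

/-- The second factor lacks its constant term because the convolution in `narP_succ` stops before i
= M. -/
theorem narSeries_eq : narSeries = 1 + PowerSeries.X * narSeries +
    PowerSeries.C (X : ℚ[X]) * PowerSeries.X * (narSeries * (narSeries - 1)) := by
  ext1 n
  cases n with
  | zero => simp [narSeries, mul_assoc]
  | succ M =>
    rw [map_add, map_add, mul_assoc, PowerSeries.coeff_C_mul, PowerSeries.coeff_succ_X_mul,
      PowerSeries.coeff_succ_X_mul, PowerSeries.coeff_mul,
      Finset.Nat.sum_antidiagonal_eq_sum_range_succ (fun i j =>
        PowerSeries.coeff i narSeries * PowerSeries.coeff j (narSeries - 1)),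
      Finset.sum_range_succ, Nat.sub_self]
    have h0 : PowerSeries.coeff 0 (narSeries - 1) = 0 := by simp [narSeries]
    rw [h0, mul_zero, add_zero]
    simp only [narSeries, PowerSeries.coeff_mk, narP_succ, PowerSeries.coeff_one]
    rw [if_neg (by omega), zero_add]
    congr 2
    refine Finset.sum_congr rfl fun i hi => ?_
    rw [Finset.mem_range] at hi
    rw [map_sub, PowerSeries.coeff_mk, PowerSeries.coeff_one, if_neg (by omega), sub_zero]

/-- Differentiating the quadratic equation of the series gives a first-order linear differential
equation whose coefficients are polynomials; the recurrence is its coefficient at M+2. -/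
theorem narP_three_term (M : ℕ) : ((M : ℚ[X]) + 3) * narP (M + 2) =
    (2 * (M : ℚ[X]) + 3) * ((1 + X) * narP (M + 1)) - (M : ℚ[X]) * ((1 - X) ^ 2 * narP M) := by
  set y : PowerSeries ℚ[X] := PowerSeries.X with hy
  set x : PowerSeries ℚ[X] := PowerSeries.C X with hx
  set P := narSeries with hP
  have hq : P = 1 + y * P + x * y * (P * (P - 1)) := narSeries_eq
  set P' := PowerSeries.derivative ℚ[X] P with hP'
  have hd : P' = P + y * P' + x * (P * (P - 1)) + x * y * (P' * (P - 1) + P * P') := by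
    have h := congrArg (PowerSeries.derivative ℚ[X]) hq
    simp only [map_add, Derivation.leibniz, map_sub, smul_eq_mul, hy, hx,
      PowerSeries.derivative_C, PowerSeries.derivative_X, Derivation.map_one_eq_zero] at h
    rw [← hP'] at h
    linear_combination h
  -- The first factor is a square root of the discriminant of the quadratic; multiplying by it once
  -- more makes the coefficient of y P' free of P.
  have hE : (1 - y + x * y - 2 * x * y * P) * (y * P') = P - 1 := by
    linear_combination y * hd - hq
  have hode : y * P' - 2 * ((1 + x) * (y * (y * P'))) + (1 - x) ^ 2 * (y * (y * (y * P'))) =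
      1 + y - x * y - P + (1 + x) * (y * P) := by
    linear_combination (1 - y + x * y - 2 * x * y * P) * hE + (2 + 4 * x * y * (y * P')) * hq
  obtain ⟨a, ha⟩ : ∃ a : ℚ[X], a = 1 + X := ⟨_, rfl⟩
  obtain ⟨b, hb⟩ : ∃ b : ℚ[X], b = (1 - X) ^ 2 := ⟨_, rfl⟩
  have hx1 : 1 + x = PowerSeries.C a := by simp [hx, ha]
  have hx2 : (1 - x) ^ 2 = PowerSeries.C b := by simp [hx, hb]
  have h2 : (2 : PowerSeries ℚ[X]) = PowerSeries.C (2 : ℚ[X]) := (map_ofNat PowerSeries.C 2).symm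
  have hc := congrArg (PowerSeries.coeff (M + 2)) hode
  have hder : ∀ n, PowerSeries.coeff n P' = narP (n + 1) * (n + 1) := by
    intro n
    rw [hP', PowerSeries.coeff_derivative, hP, narSeries, PowerSeries.coeff_mk]
  have hPc : ∀ n, PowerSeries.coeff n P = narP n := fun n => by
    rw [hP, narSeries, PowerSeries.coeff_mk]
  rw [hx1, hx2, h2] at hc
  simp only [map_add, map_sub, PowerSeries.coeff_C_mul, hy, hx, PowerSeries.coeff_succ_X_mul,
    hder, hPc, PowerSeries.coeff_one, PowerSeries.coeff_X, Nat.cast_add, Nat.cast_one] at hc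
  have hM : PowerSeries.coeff M (PowerSeries.X * P') = (M : ℚ[X]) * narP M := by
    cases M with
    | zero => simp
    | succ M => rw [PowerSeries.coeff_succ_X_mul, hder]; push_cast; ring
  rw [hM, if_neg (by omega), if_neg (by omega)] at hc
  rw [← ha, ← hb]
  linear_combination hc

/-- This is the three-term recurrence for the closed form, cleared of denominators. Everything
reduces to `M.choose k` by Pascal's rule and the ratio of consecutive binomials. -/
theorem narayana_identity (M k : ℕ) :
    ((M : ℚ) + 1) * (M + 3) * ((M + 2).choose (k + 2) * (M + 2).choose (k + 3)) =
      (M + 2) * (2 * M + 3) * ((M + 1).choose (k + 2) * (M + 1).choose (k + 3) +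
        (M + 1).choose (k + 1) * (M + 1).choose (k + 2)) -
      (M + 1) * (M + 2) * (M.choose (k + 2) * M.choose (k + 3) -
        2 * (M.choose (k + 1) * M.choose (k + 2)) + M.choose k * M.choose (k + 1)) := by
  have key : ∀ j, (M.choose (j + 1) : ℚ) = M.choose j * (M - j) / (j + 1) := by
    intro j
    rw [eq_div_iff (by positivity)]
    rcases le_or_gt j M with h | h
    · have := Nat.choose_succ_right_eq M j
      rw [← Nat.cast_sub h]
      exact_mod_cast this
    · rw [Nat.choose_eq_zero_of_lt h, Nat.choose_eq_zero_of_lt (by omega)]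
      simp
  have p1 : ∀ j, ((M + 1).choose (j + 1) : ℚ) = M.choose j + M.choose (j + 1) := fun j => by
    rw [Nat.choose_succ_succ]; push_cast; rfl
  have p2 : ∀ j, ((M + 2).choose (j + 2) : ℚ) =
      M.choose j + 2 * M.choose (j + 1) + M.choose (j + 2) := fun j => by
    rw [Nat.choose_succ_succ, Nat.choose_succ_succ, Nat.choose_succ_succ M]; push_cast; ring
  rw [p2 k, p2 (k + 1), p1 k, p1 (k + 1), p1 (k + 2), key (k + 2), key (k + 1), key k]
  push_cast
  field_simp
  ring

theorem cast_mul_coeff_narP (N k : ℕ) :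
    (N : ℚ) * (narP N).coeff k = N.choose k * N.choose (k + 1) := by
  induction N using Nat.strong_induction_on generalizing k with
  | _ N ih =>
    match N with
    | 0 => simp
    | 1 =>
      have : narP 1 = 1 := by rw [narP_succ]; simp
      rw [this]
      rcases k with _ | k
      · simp
      · simp [coeff_one, Nat.choose_eq_zero_of_lt]
    | M + 2 =>
      have ih0 := fun k => ih M (by omega) k
      have ih1 := fun k => ih (M + 1) (by omega) k
      have h3 := narP_three_term M
      have e1 : (1 - X : ℚ[X]) ^ 2 * narP M = narP M - 2 * (X * narP M) + X * (X * narP M) := by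
        ring
      have e2 : (1 + X : ℚ[X]) * narP (M + 1) = narP (M + 1) + X * narP (M + 1) := by ring
      rw [e1, e2] at h3
      have hcast : ((M : ℚ[X]) + 3) = C ((M : ℚ) + 3) := by
        rw [map_add, map_natCast, map_ofNat]
      have hcast' : (2 * (M : ℚ[X]) + 3) = C (2 * (M : ℚ) + 3) := by
        rw [map_add, map_mul, map_natCast, map_ofNat, map_ofNat]
      have hcast2 : (2 : ℚ[X]) = C (2 : ℚ) := (map_ofNat C 2).symm
      have hcast3 : (M : ℚ[X]) = C (M : ℚ) := (map_natCast C M).symm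
      rw [hcast, hcast', hcast2, hcast3] at h3
      have hc := congrArg (fun p => p.coeff k) h3
      have key : ((M : ℚ) + 3) * (M + 1) * (((M : ℚ) + 2) * (narP (M + 2)).coeff k) =
          (M + 1) * (M + 3) * ((M + 2).choose k * (M + 2).choose (k + 1)) := by
        have g1 : ∀ k, ((M : ℚ) + 1) * (narP (M + 1)).coeff k =
            (M + 1).choose k * (M + 1).choose (k + 1) := fun k => by
          rw [← ih1 k]; push_cast; ring
        have half : ∀ m : ℕ, ((m.choose 2 : ℕ) : ℚ) = m * (m - 1) / 2 := fun m => by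
          rw [Nat.cast_choose_two]
        -- The factor (1 - X)² reaches two coefficients down, so the first two coefficients are
        -- separate.
        rcases k with _ | _ | k
        · simp only [coeff_C_mul, coeff_sub, coeff_add, coeff_X_mul_zero] at hc
          have a0 := ih0 0
          have a1 := g1 0
          simp only [Nat.choose_zero_right, zero_add, Nat.choose_one_right] at a0 a1 ⊢
          push_cast at a0 a1 ⊢
          linear_combination (M + 1) * (M + 2) * hc + (2 * M + 3) * (M + 2) * a1 -
            (M + 1) * (M + 2) * a0
        · simp only [coeff_C_mul, coeff_sub, coeff_add, coeff_X_mul_zero, zero_add,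
            coeff_X_mul] at hc
          rw [show (1 : ℕ) = 0 + 1 from rfl] at hc
          simp only [zero_add] at hc
          have a0 := ih0 0
          have a1 := g1 0
          have b0 := ih0 1
          have b1 := g1 1
          simp only [Nat.choose_zero_right, zero_add, Nat.choose_one_right, Nat.reduceAdd,
            half] at a0 a1 b0 b1 ⊢
          push_cast at a0 a1 b0 b1 ⊢
          linear_combination (M + 1) * (M + 2) * hc + (2 * M + 3) * (M + 2) * (a1 + b1) -
            (M + 1) * (M + 2) * (b0 - 2 * a0)
        · simp only [coeff_C_mul, coeff_sub, coeff_add, coeff_X_mul] at hc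
          have a0 := ih0 k
          have b0 := ih0 (k + 1)
          have c0 := ih0 (k + 2)
          have a1 := g1 (k + 1)
          have b1 := g1 (k + 2)
          have := narayana_identity M k
          linear_combination (M + 1) * (M + 2) * hc + (2 * M + 3) * (M + 2) * (a1 + b1) -
            (M + 1) * (M + 2) * (c0 - 2 * b0 + a0) - this
      have hne : ((M : ℚ) + 3) * (M + 1) ≠ 0 := by positivity
      push_cast
      refine mul_left_cancel₀ hne ?_
      linear_combination key

theorem coeff_narP {N : ℕ} (hN : N ≠ 0) (k : ℕ) :
    (narP N).coeff k = N.choose k * N.choose (k + 1) / N := by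
  have : (N : ℚ) ≠ 0 := by exact_mod_cast hN
  rw [← cast_mul_coeff_narP]
  field_simp

theorem natDegree_narP_le (N : ℕ) : (narP N).natDegree ≤ N - 1 := by
  rcases Nat.eq_zero_or_pos N with rfl | hN
  · simp
  · rw [natDegree_le_iff_coeff_eq_zero]
    intro k hk
    rw [coeff_narP hN.ne', Nat.choose_eq_zero_of_lt (show N < k + 1 by omega)]
    simp

theorem reflect_narP {N : ℕ} (hN : N ≠ 0) : (narP N).reflect (N - 1) = narP N := by
  ext k
  rw [coeff_reflect]
  rcases le_or_gt k (N - 1) with hk | hk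
  · rw [revAt_le hk, coeff_narP hN, coeff_narP hN, mul_comm (N.choose k : ℚ)]
    have h1 : N - 1 - k = N - (k + 1) := by omega
    have h2 : N - 1 - k + 1 = N - k := by omega
    rw [h2, h1, Nat.choose_symm (by omega), Nat.choose_symm (by omega)]
  · rw [revAt_eq_self_of_lt hk]

theorem natDegree_narQ_le (N : ℕ) : (narQ N).natDegree ≤ N - 1 := by
  induction N using Nat.strong_induction_on with
  | _ N ih =>
    cases N with
    | zero => simp
    | succ M =>
      rw [narQ_succ]
      refine natDegree_add_le_of_degree_le ((ih M (by omega)).trans (by omega)) ?_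
      rcases Nat.eq_zero_or_pos M with rfl | hM
      · simp
      have h1 : (∑ i ∈ Finset.range M, (narP i * narQ (M - i) + narQ i * narP (M - i))).natDegree
          ≤ M - 1 := by
        refine natDegree_sum_le_of_forall_le _ _ fun i hi => ?_
        rw [Finset.mem_range] at hi
        have h2 := natDegree_narP_le i
        have h3 := natDegree_narP_le (M - i)
        have h4 := ih i (by omega)
        have h5 := ih (M - i) (by omega)
        refine natDegree_add_le_of_degree_le (natDegree_mul_le.trans ?_)
          (natDegree_mul_le.trans ?_) <;> omega
      refine natDegree_mul_le.trans ?_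
      rw [natDegree_X]
      omega

theorem coeff_zero_narP (N : ℕ) : (narP N).coeff 0 = 1 := by
  induction N with
  | zero => simp
  | succ N ih => rw [narP_succ, coeff_add, coeff_X_mul_zero, ih, add_zero]

theorem coeff_zero_narQ (N : ℕ) : (narQ N).coeff 0 = 1 := by
  induction N with
  | zero => simp
  | succ N ih => rw [narQ_succ, coeff_add, coeff_X_mul_zero, ih, add_zero]

theorem coeff_one_narQ (N : ℕ) : (narQ N).coeff 1 = N * (N - 1) := by
  induction N with
  | zero => simp [coeff_one]
  | succ N ih =>
    have h : ∀ i ∈ Finset.range N,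
        (narP i * narQ (N - i) + narQ i * narP (N - i)).coeff 0 = 2 := by
      intro i _
      rw [coeff_add, mul_coeff_zero, mul_coeff_zero, coeff_zero_narP, coeff_zero_narP,
        coeff_zero_narQ, coeff_zero_narQ]
      norm_num
    rw [narQ_succ, coeff_add, ih, show (1 : ℕ) = 0 + 1 from rfl, coeff_X_mul, finsetSum_coeff,
      Finset.sum_congr rfl h, Finset.sum_const, Finset.card_range, nsmul_eq_mul]
    push_cast
    ring

/-- The interior part of a convolution over `i + j = M`. -/
theorem sum_range_eq_sum_Icc {R : Type*} [AddCommMonoid R] {M : ℕ} (hM : M ≠ 0) (f : ℕ → R) :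
    ∑ i ∈ Finset.range M, f i = f 0 + ∑ i ∈ Finset.Icc 1 (M - 1), f i := by
  obtain ⟨m, rfl⟩ := Nat.exists_eq_succ_of_ne_zero hM
  rw [Finset.sum_range_succ', add_comm, Nat.succ_sub_one, Finset.range_eq_Ico,
    Finset.sum_Ico_add' f 0 m 1]
  rfl

theorem sum_Icc_reflect {R : Type*} [AddCommMonoid R] (M : ℕ) (f : ℕ → ℕ → R) :
    ∑ i ∈ Finset.Icc 1 (M - 1), f i (M - i) = ∑ i ∈ Finset.Icc 1 (M - 1), f (M - i) i := by
  refine Finset.sum_nbij' (fun i => M - i) (fun i => M - i) ?_ ?_ ?_ ?_ ?_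
  · intro i hi; rw [Finset.mem_Icc] at *; omega
  · intro i hi; rw [Finset.mem_Icc] at *; omega
  · intro i hi; rw [Finset.mem_Icc] at hi; omega
  · intro i hi; rw [Finset.mem_Icc] at hi; omega
  · intro i hi
    rw [Finset.mem_Icc] at hi
    congr 1
    omega

/-- The terms with i = 0 are split off; the symmetry i ↔ M - i merges the two remaining sums. -/
theorem narQ_recurrence {M : ℕ} (hM : M ≠ 0) :
    narQ (M + 1) = narQ M + X * narQ M +
      2 * ∑ i ∈ Finset.Icc 1 (M - 1), X * narP i * narQ (M - i) + X * narP M := by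
  rw [narQ_succ, Finset.sum_add_distrib, sum_range_eq_sum_Icc hM, sum_range_eq_sum_Icc hM,
    sum_Icc_reflect M fun i j => narQ i * narP j]
  simp only [mul_assoc, ← Finset.mul_sum, mul_comm (narQ _) (narP _), narP_zero, narQ_zero,
    Nat.sub_zero]
  ring

/-- This is the recursion of `narQ` for N `narP N`, up to the last term: averaging over i ↔ M - i
replaces the factor M - i by M/2. -/
theorem narP_recurrence {M : ℕ} (hM : M ≠ 0) :
    ((M : ℚ[X]) + 1) * narP (M + 1) = (M : ℚ[X]) * narP M + X * ((M : ℚ[X]) * narP M) +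
      2 * ∑ i ∈ Finset.Icc 1 (M - 1), X * narP i * (((M - i : ℕ) : ℚ[X]) * narP (M - i)) +
      narP (M + 1) := by
  have h1 : 2 * ∑ i ∈ Finset.Icc 1 (M - 1), X * narP i * (((M - i : ℕ) : ℚ[X]) * narP (M - i)) =
      ∑ i ∈ Finset.Icc 1 (M - 1), (M : ℚ[X]) * (X * (narP i * narP (M - i))) := by
    rw [two_mul]
    nth_rw 1 [sum_Icc_reflect M fun i j => X * narP i * ((j : ℚ[X]) * narP j)]
    rw [← Finset.sum_add_distrib]
    refine Finset.sum_congr rfl fun i hi => ?_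
    rw [Finset.mem_Icc] at hi
    rw [Nat.cast_sub (by omega)]
    ring
  have h2 : narP (M + 1) = narP M + X * (narP M + ∑ i ∈ Finset.Icc 1 (M - 1),
      narP i * narP (M - i)) := by
    rw [narP_succ, sum_range_eq_sum_Icc hM]
    simp
  rw [h1, ← Finset.mul_sum, ← Finset.mul_sum]
  linear_combination (M : ℚ[X]) * h2

theorem reflect_X_pow_mul {f : ℚ[X]} {a F : ℕ} (b : ℕ) (hab : a ≤ b) (hf : f.natDegree ≤ F) :
    reflect (b + F) (X ^ a * f) = X ^ (b - a) * reflect F f := by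
  rw [reflect_mul _ _ ((natDegree_X_pow_le a).trans hab) hf, reflect_monomial, revAt_le hab]

/-- Reversal in degree M+2 splits over a product into degrees i+1 and M-i+1, and X `narP i` is
palindromic in degree i+1. -/
theorem narQ_reflect_recurrence {M : ℕ} (hM : M ≠ 0) :
    (narQ (M + 1)).reflect (M + 2) = (narQ M).reflect (M + 1) + X * (narQ M).reflect (M + 1) +
      2 * ∑ i ∈ Finset.Icc 1 (M - 1), X * narP i * (narQ (M - i)).reflect (M - i + 1) +
        X ^ 2 * narP M := by
  have hQ : ∀ N, (narQ N).natDegree ≤ N + 1 := fun N => (natDegree_narQ_le N).trans (by omega)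
  have h1 : reflect (M + 2) (narQ M) = X * reflect (M + 1) (narQ M) := by
    have := reflect_X_pow_mul (a := 0) 1 (by omega) (hQ M)
    rw [show M + 2 = 1 + (M + 1) by omega]
    simpa using this
  have h2 : reflect (M + 2) (X * narQ M) = reflect (M + 1) (narQ M) := by
    have := reflect_X_pow_mul (a := 1) 1 (by omega) (hQ M)
    rw [show M + 2 = 1 + (M + 1) by omega]
    simpa using this
  have hP : ∀ i, i ≠ 0 → reflect (i + 1) (X * narP i) = X * narP i := by
    intro i hi
    have := reflect_X_pow_mul (a := 1) 2 (by omega) (natDegree_narP_le i)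
    rw [reflect_narP hi, pow_one, show 2 + (i - 1) = i + 1 by omega] at this
    simpa using this
  have h3 : ∀ i ∈ Finset.Icc 1 (M - 1), reflect (M + 2) (X * narP i * narQ (M - i)) =
      X * narP i * reflect (M - i + 1) (narQ (M - i)) := by
    intro i hi
    rw [Finset.mem_Icc] at hi
    have hd : (X * narP i).natDegree ≤ i + 1 := by
      refine natDegree_mul_le.trans ?_
      have := natDegree_narP_le i
      rw [natDegree_X]
      omega
    rw [show M + 2 = (i + 1) + (M - i + 1) by omega, reflect_mul _ _ hd (hQ _), hP i (by omega)]
  have h4 : reflect (M + 2) (X * narP M) = X ^ 2 * narP M := by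
    have := reflect_X_pow_mul (a := 1) 3 (by omega) (natDegree_narP_le M)
    rw [reflect_narP hM, pow_one, show 3 + (M - 1) = M + 2 by omega] at this
    simpa using this
  let φ : ℚ[X] →+ ℚ[X] :=
    { toFun := reflect (M + 2), map_zero' := reflect_zero, map_add' := fun f g =>
        reflect_add f g _ }
  have hφ : ∀ f, φ f = reflect (M + 2) f := fun _ => rfl
  rw [narQ_recurrence hM, ← hφ, two_mul]
  rw [map_add, map_add, map_add, map_add, map_sum]
  simp only [hφ, h1, h2, h4]
  rw [Finset.sum_congr rfl h3]
  ring

/-! ### The rank generating polynomial, its recurrence and its symmetry. -/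

/-- The rank generating polynomials of the noncrossing partitions of type `(d, d, N + 1)`. -/
noncomputable def rankPoly (d N : ℕ) : ℚ[X] :=
  narQ N + (narQ N).reflect (N + 1) + (N * d : ℚ[X]) * X * narP N

/-- The three summands obey one linear recursion, with the inhomogeneous terms X `narP M`, X² `narP
M` and d X `narP (M + 1)`. -/
theorem rankPoly_recurrence (d : ℕ) {M : ℕ} (hM : M ≠ 0) :
    rankPoly d (M + 1) = rankPoly d M + X * rankPoly d M +
      2 * ∑ i ∈ Finset.Icc 1 (M - 1), X * (rankPoly d (M - i) * narP i) +
      X * ((d : ℚ[X]) * narP (M + 1) + narP M + X * narP M) := by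
  have h1 : ∑ i ∈ Finset.Icc 1 (M - 1), X * (rankPoly d (M - i) * narP i) =
      ∑ i ∈ Finset.Icc 1 (M - 1), X * narP i * narQ (M - i) +
      ∑ i ∈ Finset.Icc 1 (M - 1), X * narP i * (narQ (M - i)).reflect (M - i + 1) +
      d * X * ∑ i ∈ Finset.Icc 1 (M - 1), X * narP i * (((M - i : ℕ) : ℚ[X]) * narP (M - i)) := by
    rw [Finset.mul_sum, ← Finset.sum_add_distrib, ← Finset.sum_add_distrib]
    refine Finset.sum_congr rfl fun i _ => ?_
    rw [rankPoly]
    ring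
  have h2 := narP_recurrence hM
  rw [h1, rankPoly, rankPoly, narQ_recurrence hM, ← narQ_recurrence hM,
    narQ_reflect_recurrence hM]
  nth_rw 1 [narQ_recurrence hM]
  push_cast
  linear_combination (d : ℚ[X]) * X * h2

theorem reflect_rankPoly {d N : ℕ} (hN : N ≠ 0) :
    (rankPoly d N).reflect (N + 1) = rankPoly d N := by
  have h1 : reflect (N + 1) ((N * d : ℚ[X]) * X * narP N) = (N * d : ℚ[X]) * X * narP N := by
    have h2 := reflect_X_pow_mul (a := 1) 2 (by omega) (natDegree_narP_le N)
    rw [reflect_narP hN, pow_one, show 2 + (N - 1) = N + 1 by omega] at h2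
    have h3 : (N * d : ℚ[X]) * X * narP N = C ((N : ℚ) * d) * (X * narP N) := by
      simp [mul_assoc]
    rw [h3, reflect_C_mul, h2]
  rw [rankPoly, reflect_add, reflect_add, h1, reflect_reflect]
  ring

theorem coeff_rankPoly_sub {d N k : ℕ} (hN : N ≠ 0) (hk : k ≤ N + 1) :
    (rankPoly d N).coeff (N + 1 - k) = (rankPoly d N).coeff k := by
  conv_rhs => rw [← reflect_rankPoly hN, coeff_reflect, revAt_le hk]

theorem coeff_zero_rankPoly (d N : ℕ) : (rankPoly d N).coeff 0 = 1 := by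
  have h1 : (narQ N).coeff (N + 1) = 0 :=
    coeff_eq_zero_of_natDegree_lt (lt_of_le_of_lt (natDegree_narQ_le N) (by omega))
  rw [rankPoly, coeff_add, coeff_add, coeff_zero_narQ, coeff_reflect, revAt_le (by omega),
    Nat.sub_zero, h1, mul_coeff_zero, mul_coeff_zero, coeff_X_zero]
  ring

theorem coeff_one_rankPoly (d : ℕ) {N : ℕ} (hN : N ≠ 0) :
    (rankPoly d N).coeff 1 = N * (N + d - 1) := by
  have h1 : (narQ N).coeff N = 0 :=
    coeff_eq_zero_of_natDegree_lt (lt_of_le_of_lt (natDegree_narQ_le N) (by omega))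
  have h3 : (N * d : ℚ[X]) * X * narP N = C ((N : ℚ) * d) * (X * narP N) := by
    simp [mul_assoc]
  have h4 : (X * narP N).coeff 1 = 1 := by
    rw [show (1 : ℕ) = 0 + 1 from rfl, coeff_X_mul, coeff_zero_narP]
  rw [rankPoly, coeff_add, coeff_add, coeff_one_narQ, coeff_reflect, revAt_le (by omega),
    Nat.add_sub_cancel, h1, h3, coeff_C_mul, h4]
  ring

theorem coeff_rankPoly_recurrence (d : ℕ) {M k : ℕ} (hM : M ≠ 0) :
    (rankPoly d (M + 1)).coeff (k + 2) =
      (rankPoly d M).coeff (k + 2) + (rankPoly d M).coeff (k + 1) +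
      2 * (∑ i ∈ Finset.Icc 1 (M - 1), ∑ j ∈ Finset.range (k + 2),
        (rankPoly d (M - i)).coeff j / i * i.choose (k + 2 - j) * i.choose (k + 2 - j - 1)) +
      M.choose (k + 1) * (d / (k + 2) * (M + 1).choose (k + 1) +
        1 / M * (M.choose k + M.choose (k + 2))) := by
  have h := congrArg (fun p => p.coeff (k + 2)) (rankPoly_recurrence d hM)
  have hd : ((d : ℚ[X])) = C (d : ℚ) := by simp
  have h2 : (2 : ℚ[X]) = C (2 : ℚ) := (map_ofNat C 2).symm
  rw [h2, hd] at h
  simp only [coeff_add, coeff_X_mul, coeff_C_mul, finsetSum_coeff] at h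
  rw [h]
  congr 1
  · congr 2
    refine Finset.sum_congr rfl fun i hi => ?_
    rw [Finset.mem_Icc] at hi
    rw [coeff_mul, Finset.Nat.sum_antidiagonal_eq_sum_range_succ (fun a b =>
      (rankPoly d (M - i)).coeff a * (narP i).coeff b)]
    refine Finset.sum_congr rfl fun j hj => ?_
    rw [Finset.mem_range] at hj
    rw [coeff_narP (by omega), show k + 2 - j = k + 1 - j + 1 by omega, Nat.add_sub_cancel]
    ring
  · rw [coeff_narP (by omega), coeff_narP hM, coeff_narP hM]
    -- Absorption rewrites the larger binomial of the Narayana number of M+1 and produces the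
    -- denominator k+2.
    have h3 := Nat.add_one_mul_choose_eq M (k + 1)
    have h4 : ((M : ℚ) + 1) * M.choose (k + 1) = (M + 1).choose (k + 2) * (k + 2) := by
      exact_mod_cast h3
    have h5 : ((M + 1).choose (k + 1 + 1) : ℚ) = (M + 1) * M.choose (k + 1) / (k + 2) := by
      rw [eq_div_iff (by positivity), h4]
    have hM' : (M : ℚ) ≠ 0 := by exact_mod_cast hM
    rw [h5]
    push_cast
    field_simp
    ring

end Narayana

/-! ### Rank numbers as coefficients, and the conclusion. -/

namespace Gddn

theorem rankNumber_eq_coeff {d m : ℕ} (hd : 2 ≤ d) {c : groupGddn d (m + 2)}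
    (hc : IsCoxeterElement (groupGddn d (m + 2)) c) (k : ℕ) :
    (rankNumber (NCPartition (groupGddn d (m + 2)) c) k : ℚ) = (rankPoly d (m + 1)).coeff k := by
  have : NeZero d := ⟨by omega⟩
  obtain ⟨b, l, hl, hlen⟩ := exists_isCoxeterLike hd hc
  rw [rankNumber_eq hl k, hlen, rankPoly]

end Gddn

theorem coeff_rankPoly_eq_zero {d N k : ℕ} (hk : N + 1 < k) : (rankPoly d N).coeff k = 0 := by
  have h1 := natDegree_narQ_le N
  have h2 := natDegree_narP_le N
  obtain ⟨k, rfl⟩ := Nat.exists_eq_succ_of_ne_zero (show k ≠ 0 by omega)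
  have h3 : (N * d : Polynomial ℚ) * Polynomial.X * narP N =
      Polynomial.C ((N : ℚ) * d) * (Polynomial.X * narP N) := by
    simp [mul_assoc]
  rw [rankPoly, h3, Polynomial.coeff_add, Polynomial.coeff_add, Polynomial.coeff_reflect,
    Polynomial.revAt_eq_self_of_lt hk, Polynomial.coeff_C_mul, Nat.succ_eq_add_one,
    Polynomial.coeff_X_mul, Polynomial.coeff_eq_zero_of_natDegree_lt (by omega),
    Polynomial.coeff_eq_zero_of_natDegree_lt (by omega)]
  ring

theorem proposition3p10 (d n : ℕ) (hd : 2 ≤ d) (hn : 2 ≤ n)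
    (c : ∀ m : ℕ, groupGddn d m)
    (hc : ∀ m : ℕ, 2 ≤ m → m ≤ n → IsCoxeterElement (groupGddn d m) (c m))
    (r : ℕ → ℕ → ℕ)
    (hr : ∀ k m : ℕ, r k m = rankNumber (NCPartition (groupGddn d m) (c m)) k) :
    (r 0 n = 1 ∧ r n n = 1 ∧ ∀ k : ℕ, n < k → r k n = 0) ∧
    (r 1 n = (n - 1) * (n + d - 2) ∧ r (n - 1) n = (n - 1) * (n + d - 2)) ∧
    ∀ k : ℕ, 2 ≤ k → k + 2 ≤ n →
      (r k n : ℚ) = r k (n - 1) + r (k - 1) (n - 1)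
        + 2 * (∑ i ∈ Finset.Icc 1 (n - 3), ∑ j ∈ Finset.range k,
            (r j (n - i - 1) : ℚ) / (i : ℚ)
              * (Nat.choose i (k - j) : ℚ) * (Nat.choose i (k - j - 1) : ℚ))
        + (Nat.choose (n - 2) (k - 1) : ℚ)
          * ((d : ℚ) / (k : ℚ) * (Nat.choose (n - 1) (k - 1) : ℚ)
            + 1 / ((n : ℚ) - 2)
              * ((Nat.choose (n - 2) (k - 2) : ℚ) + (Nat.choose (n - 2) k : ℚ))) := by
  have key : ∀ k m, m + 2 ≤ n → (r k (m + 2) : ℚ) = (rankPoly d (m + 1)).coeff k :=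
    fun k m hm => by rw [hr, Gddn.rankNumber_eq_coeff hd (hc (m + 2) (by omega) hm)]
  clear hr hc
  obtain ⟨M, rfl⟩ := Nat.exists_eq_add_of_le' hn
  have h1 : (rankPoly d (M + 1)).coeff 1 = ((M + 2 - 1) * (M + 2 + d - 2) : ℕ) := by
    rw [coeff_one_rankPoly d M.succ_ne_zero, show M + 2 - 1 = M + 1 by omega,
      show M + 2 + d - 2 = M + d by omega]
    push_cast
    ring
  refine ⟨⟨?_, ?_, ?_⟩, ⟨?_, ?_⟩, ?_⟩
  · have h := key 0 M le_rfl
    rw [coeff_zero_rankPoly] at h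
    exact_mod_cast h
  · have h := key (M + 2) M le_rfl
    rw [show M + 2 = M + 1 + 1 - 0 by omega, coeff_rankPoly_sub M.succ_ne_zero (by omega),
      coeff_zero_rankPoly] at h
    exact_mod_cast h
  · intro k hk
    have h := key k M le_rfl
    rw [coeff_rankPoly_eq_zero hk] at h
    exact_mod_cast h
  · have h := key 1 M le_rfl
    rw [h1] at h
    exact_mod_cast h
  · have h := key (M + 2 - 1) M le_rfl
    have h2 := coeff_rankPoly_sub (d := d) (k := 1) M.succ_ne_zero (by omega)
    rw [Nat.succ_eq_add_one, h1] at h2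
    rw [show M + 1 + 1 - 1 = M + 2 - 1 by omega] at h2
    rw [h2] at h
    exact_mod_cast h
  · intro k hk hkn
    obtain ⟨k, rfl⟩ := Nat.exists_eq_add_of_le' hk
    obtain ⟨M, rfl⟩ := Nat.exists_eq_add_of_le' (show 1 ≤ M by omega)
    have h := coeff_rankPoly_recurrence d (k := k) M.succ_ne_zero
    -- Now n = M + 3, and i ≤ M keeps n - i - 1 ≥ 2, so `key` applies to every term of the double
    -- sum.
    have hsum : ∀ i ∈ Finset.Icc 1 (M + 1 + 2 - 3), ∀ j,
        (r j (M + 1 + 2 - i - 1) : ℚ) = (rankPoly d (M + 1 - i)).coeff j := by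
      intro i hi j
      rw [Finset.mem_Icc] at hi
      rw [show M + 1 + 2 - i - 1 = M - i + 2 by omega, key j (M - i) (by omega),
        show M - i + 1 = M + 1 - i by omega]
    rw [show M + 1 + 2 - 1 = M + 2 by omega, key _ (M + 1) le_rfl, key _ M (by omega),
      key _ M (by omega), Finset.sum_congr rfl fun i hi => Finset.sum_congr rfl fun j _ => by
        rw [hsum i hi j], h, show M + 1 + 2 - 2 = M + 1 by omega,
      show k + 2 - 2 = k by omega, show k + 2 - 1 = k + 1 by omega,
      show M + 1 + 2 - 3 = M + 1 - 1 by omega]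
    have e : ((M + 1 + 2 : ℕ) : ℚ) - 2 = ((M + 1 : ℕ) : ℚ) := by push_cast; ring
    have e' : ((k + 2 : ℕ) : ℚ) = k + 2 := by push_cast; ring
    rw [e, e']
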